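/- Let $F$ be a fixed finite field. A capacitated network $\mathcal N$ consists of a finite directed acyclic multigraph with node set $\nu$ and edge set $\epsilon$, a finite message set $\mu$, positive integer edge capacities $c(e)$, an alphabet $\mathcal A$ with $|\mathcal A|\le |F|$, and maps assigning to each node the set of messages it generates and the set of messages it demands. Networks are assumed non-degenerate: for each demand of a message at a node there is a directed path from some node generating the message to that node, no node both generates and demands the same message, and every message is demanded by at least one node. For positive integers $k_m$ ($m\in\mu$) and $n$, a fractional network code over $F$ carries a vector of $F^{k_m}$ for each message $m$ and a vector of $F^{n c(e)}$ on each edge $e$; it assigns to each edge a function computing its vector from the messages generated at, and the vectors on the edges entering, its tail, and to each demand at a node a decoding function of the messages generated at, and the vectors on the edges entering, that node. It is linear if all these functions are $F$-linear, and it is a solution if every demand is satisfied for every assignment of vectors to the messages. The linear coding capacity region $\mathcal C_l\subseteq\mathbb R^{\mu}$ (with respect to $F$) is the closure of the set of vectors $(k_m/n)_{m\in\mu}$ for which a linear solution exists. For a weight vector $w\in\{0,1\}^{\mu}$, a partial scalar-linear solution is a linear solution, with all $k_m=1$ and $n=1$, of the network in which only the messages with $w_m=1$ are considered and all edges have unit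 capacity; it uses an edge if its function for that edge is not identically zero. A fractional code with parameters $(k,n)$ is simple if it is linear and is an aggregate of finitely many partial scalar-linear solutions: the $k_m$ coordinates of each message $m$ are distributed, one each, among the partial solutions whose weight vector selects $m$; on each edge $e$ every partial solution that uses $e$ has its own one of the $n c(e)$ coordinates; each partial solution acts on its own coordinates, and the remaining edge coordinates carry $0$. The semi-network linear coding capacity region $\mathcal C'_l$ is the closure of the set of vectors $(k_m/n)_{m\in\mu}$, with all $k_m$ and $n$ positive integers, for which a simple code exists. **Theorem.** $\mathcal C'_l$ is a bounded rational polytope (the convex hull of finitely many rational points) contained in $\mathbb R_+^{\mu}$, and $\mathcal C'_l\subseteq\mathcal C_l$. Moreover $\mathcal C'_l$ is computable: there is an algorithm, depending only on $F$, that, given a finite description of any such network, outputs the list of the vertices of $\mathcal C'_l$, which are rational vectors and whose convex hull is $\mathcal C'_l$. -/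

import Mathlib

/-- A capacitated network: a finite directed acyclic multigraph with node set `V`, edge set `E`
and message set `M` (finiteness of the three types is assumed where it is used), positive integer
edge capacities, an alphabet (only its number of letters is recorded), a source mapping and a
receiver mapping. -/
structure CapacitatedNetwork (V E M : Type*) where
  /-- the node at which an edge starts -/
  tail : E → V
  /-- the node at which an edge ends -/
  head : E → V
  /-- the edge capacities -/
  cap : E → ℕ
  cap_pos : ∀ e, 0 < cap e
  /-- the number of letters of the alphabet -/
  alphabetCard : ℕ
  /-- the messages generated by a node -/
  source : V → Finset M
  /-- the messages demanded by a node -/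
  receiver : V → Finset M
  /-- there is no directed cycle -/
  acyclic : ∀ x, ¬ Relation.TransGen (fun y z => ∃ e, tail e = y ∧ head e = z) x x

namespace CapacitatedNetwork

variable {V E M : Type*}

/-- Non-degenerate networks: each demanded message can reach the demanding node along a directed
path from some node generating it, no node both generates and demands a message, and every
message is demanded by some node. -/
structure NonDegenerate (N : CapacitatedNetwork V E M) : Prop where
  path : ∀ x, ∀ m ∈ N.receiver x, ∃ y, m ∈ N.source y ∧
    Relation.ReflTransGen (fun y z => ∃ e, N.tail e = y ∧ N.head e = z) y x
  disjoint : ∀ x, ∀ m ∈ N.source x, m ∉ N.receiver x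
  demanded : ∀ m, ∃ x, m ∈ N.receiver x

/-- What a node `x` sees: a vector in `F ^ k m` for every message `m` that it generates and a
vector in `F ^ (n * cap e)` for every edge `e` that ends in `x`. -/
abbrev NodeInput (N : CapacitatedNetwork V E M) (F : Type*) (k : M → ℕ) (n : ℕ) (x : V) : Type _ :=
  (∀ m : {m // m ∈ N.source x}, Fin (k m.1) → F) ×
    (∀ e : {e // N.head e = x}, Fin (n * N.cap e.1) → F)

/-- A fractional network code over `F` with source dimension vector `k` and edge dimension `n`:
a fractional edge function for every edge, and a fractional decoding function for every node and
every message that the node demands. -/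
structure FractionalCode (N : CapacitatedNetwork V E M) (F : Type*) (k : M → ℕ) (n : ℕ) where
  edgeFun : ∀ e, N.NodeInput F k n (N.tail e) → (Fin (n * N.cap e) → F)
  decFun : ∀ x (m : {m // m ∈ N.receiver x}), N.NodeInput F k n x → (Fin (k m.1) → F)

/-- What the node `x` sees when the messages are `a` and the edges carry `s`. -/
def inputAt (N : CapacitatedNetwork V E M) {F : Type*} {k : M → ℕ} {n : ℕ}
    (a : ∀ m, Fin (k m) → F) (s : ∀ e, Fin (n * N.cap e) → F) (x : V) : N.NodeInput F k n x :=
  (fun m => a m.1, fun e => s e.1)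

namespace FractionalCode

variable {N : CapacitatedNetwork V E M} {F : Type*} {k : M → ℕ} {n : ℕ}

/-- All edge functions and all decoding functions are linear over `F`. -/
def IsLinear [Field F] (C : N.FractionalCode F k n) : Prop :=
  (∀ e, IsLinearMap F (C.edgeFun e)) ∧ ∀ x m, IsLinearMap F (C.decFun x m)

/-- The code is a solution: for every message assignment `a`, with `s e` the vector that the code
sends along the edge `e` (as the network is acyclic, there is exactly one such family `s`), every
demand is satisfied. -/
def IsSolution (C : N.FractionalCode F k n) : Prop :=
  ∀ a : (∀ m, Fin (k m) → F), ∃ s : (∀ e, Fin (n * N.cap e) → F),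
    (∀ e, s e = C.edgeFun e (N.inputAt a s (N.tail e))) ∧
    ∀ x (m : {m // m ∈ N.receiver x}), C.decFun x m (N.inputAt a s x) = a m.1

/-- The code uses the edge `e`, i.e. its edge function does not vanish identically. -/
def Uses [Zero F] (C : N.FractionalCode F k n) (e : E) : Prop :=
  ∃ u, C.edgeFun e u ≠ 0

end FractionalCode

/-- The network in which only the messages `m` with `w m = 1` are considered and all edges have
unit capacity. -/
def restrict (N : CapacitatedNetwork V E M) (w : M → Bool) :
    CapacitatedNetwork V E {m // w m = true} where
  tail := N.tail
  head := N.head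
  cap := fun _ => 1
  cap_pos := fun _ => Nat.one_pos
  alphabetCard := N.alphabetCard
  source := fun x => (N.source x).subtype (fun m => w m = true)
  receiver := fun x => (N.receiver x).subtype (fun m => w m = true)
  acyclic := N.acyclic

/-- Scalar codes (source dimensions and edge dimension equal to one) for the messages selected by
the 0-1 vector `w`, with unit edge capacities. -/
abbrev PartialScalarCode (N : CapacitatedNetwork V E M) (F : Type*) (w : M → Bool) : Type _ :=
  (N.restrict w).FractionalCode F (fun _ => 1) 1

/-- The data by which partial scalar-linear solutions `part j`, `j < r`, with weight vectors
`weight j`, are put side by side in a code with source dimensions `k` and edge dimension `n`: the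
coordinates of message `m` are distributed, one each, among those `j` whose weight vector selects
`m`, and on every edge `e` each `j` that uses `e` has a coordinate of `e` of its own. -/
structure AggregateData (N : CapacitatedNetwork V E M) (F : Type*) [Field F] (k : M → ℕ)
    (n : ℕ) where
  r : ℕ
  weight : Fin r → M → Bool
  part : ∀ j, N.PartialScalarCode F (weight j)
  part_linear : ∀ j, (part j).IsLinear
  part_solution : ∀ j, (part j).IsSolution
  msgCoord : ∀ m, {j // weight j m = true} ≃ Fin (k m)
  edgeCoord : ∀ e, {j // (part j).Uses e} ↪ Fin (n * N.cap e)

namespace AggregateData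

variable {N : CapacitatedNetwork V E M} {F : Type*} [Field F] {k : M → ℕ} {n : ℕ}

open Classical in
/-- The share of the `j`-th partial solution in what the node `x` sees (an edge that the `j`-th
partial solution does not use carries zero in it). -/
noncomputable def share (D : N.AggregateData F k n) (j : Fin D.r) {x : V}
    (u : N.NodeInput F k n x) : (N.restrict (D.weight j)).NodeInput F (fun _ => 1) 1 x :=
  (fun m _ => u.1 ⟨m.1.1, Finset.mem_subtype.1 m.2⟩ (D.msgCoord m.1.1 ⟨j, m.1.2⟩),
    fun e _ => if h : (D.part j).Uses e.1 then u.2 ⟨e.1, e.2⟩ (D.edgeCoord e.1 ⟨j, h⟩) else 0)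

/-- The code `C` is the aggregate described by `D`: each partial solution acts on its own
coordinates, and the edge coordinates that belong to no partial solution carry zero. -/
structure Describes (D : N.AggregateData F k n) (C : N.FractionalCode F k n) : Prop where
  edge : ∀ e u (j : {j // (D.part j).Uses e}) i,
    C.edgeFun e u (D.edgeCoord e j) = (D.part j.1).edgeFun e (D.share j.1 u) i
  edge_inactive : ∀ e u c, c ∉ Set.range (D.edgeCoord e) → C.edgeFun e u c = 0
  dec : ∀ x (m : {m // m ∈ N.receiver x}) u (j : {j // D.weight j m.1 = true}) i,
    C.decFun x m u (D.msgCoord m.1 j) =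
      (D.part j.1).decFun x ⟨⟨m.1, j.2⟩, Finset.mem_subtype.2 m.2⟩ (D.share j.1 u) i

end AggregateData

/-- Simple fractional linear network code solutions: linear codes that can be written as an
aggregate of partial scalar-linear solutions. -/
def FractionalCode.IsSimple {N : CapacitatedNetwork V E M} {F : Type*} [Field F] {k : M → ℕ}
    {n : ℕ} (C : N.FractionalCode F k n) : Prop :=
  C.IsLinear ∧ ∃ D : N.AggregateData F k n, D.Describes C

/-- The network linear coding capacity region with respect to `F`: the closure of the set of all
vectors `k / n`, with `k` and `n` positive, for which there is a fractional linear network code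
solution. -/
def linearRegion (N : CapacitatedNetwork V E M) (F : Type*) [Field F] : Set (M → ℝ) :=
  closure {x | ∃ (k : M → ℕ) (n : ℕ), (∀ m, 0 < k m) ∧ 0 < n ∧
    (∃ C : N.FractionalCode F k n, C.IsLinear ∧ C.IsSolution) ∧
    x = fun m => (k m : ℝ) / (n : ℝ)}

/-- The semi-network linear coding capacity region with respect to `F`: the closure of the set of
all vectors `k / n`, with `k` and `n` positive, for which there is a simple fractional linear
network code solution. -/
def semiLinearRegion (N : CapacitatedNetwork V E M) (F : Type*) [Field F] : Set (M → ℝ) :=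
  closure {x | ∃ (k : M → ℕ) (n : ℕ), (∀ m, 0 < k m) ∧ 0 < n ∧
    (∃ C : N.FractionalCode F k n, C.IsSimple) ∧
    x = fun m => (k m : ℝ) / (n : ℝ)}

/-- Finite descriptions of networks: the number of nodes, the number of messages, the number of
letters of the alphabet, the list of edges (tail, head, capacity), and for each node the list of
the messages generated and the list of the messages demanded. -/
abbrev Description : Type :=
  ℕ × ℕ × ℕ × List (ℕ × ℕ × ℕ) × List (List ℕ) × List (List ℕ)

/-- The description of a network with numbered nodes, edges and messages. -/
def description {v e m : ℕ} (N : CapacitatedNetwork (Fin v) (Fin e) (Fin m)) : Description :=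
  (v, m, N.alphabetCard,
    List.ofFn fun i : Fin e => ((N.tail i : ℕ), (N.head i : ℕ), N.cap i),
    List.ofFn fun x : Fin v => ((List.finRange m).filter (· ∈ N.source x)).map Fin.val,
    List.ofFn fun x : Fin v => ((List.finRange m).filter (· ∈ N.receiver x)).map Fin.val)

end CapacitatedNetwork

/-- The real vector with the given rational coordinates. -/
def ratVec {ι : Type*} (q : ι → ℚ) : ι → ℝ := fun i => (q i : ℝ)

/-- A (bounded) rational polytope: the convex hull of finitely many rational points. -/
def IsRationalPolytope {ι : Type*} (P : Set (ι → ℝ)) : Prop :=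
  ∃ T : Set (ι → ℚ), T.Finite ∧ P = convexHull ℝ (ratVec '' T)

/-- A list of rational vectors with nonnegative coordinates, written down as lists of pairs
(numerator, denominator) of natural numbers in lowest terms. -/
def writeVectors {m : ℕ} (L : List (Fin m → ℚ)) : List (List (ℕ × ℕ)) :=
  L.map fun q => List.ofFn fun i => ((q i).num.toNat, (q i).den)

/-! For the capacity count, a partial scalar-linear solution matters only through its weight vector
and a set of edges containing those it uses, so there are finitely many types `i`. A simple code
with edge dimension `n` amounts to multiplicities `c i` for these types: every message dimension is
the number of chosen parts that carry the message, and on every edge the number of parts using it is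
at most `n` times the capacity (`IsFeasibleFamily.exists_isSimple_iff`). Dividing by `n` and taking
closures, the region is the image of the polytope of fractional packings under the linear rate map
(`IsFeasibleFamily.semiLinearRegion_eq_image`). The delicate point is that all source dimensions
must be positive: a real packing is rounded down, and every message is then flooded once, at a cost
that vanishes in the limit. Non-degeneracy enters through flooding and through boundedness, since a
part with nonzero weight needs at least one edge.

Computability is obtained by turning every question into a search over an explicit finite list.
Whether a type admits a partial solution is a statement about kernels of linear forms over a finite
field (`partialFeasible_iff`). Cramer's rule bounds the denominators of vertices in terms of the
size of the system (`exists_int_of_mem_extremePoints`), so the region is the convex hull of the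
rates with one fixed denominator (`image_rates_packingPolytope`). Such a point is a vertex unless it
is a convex combination of the other ones; the denominator bound, applied this time to the polytope
of coefficients, makes this a finite test (`mem_extremePoints_convexHull_iff`). The resulting
function is primitive recursive (`regionVertices_primrec`).

The inclusion in the linear region holds because an aggregate of solutions is a solution
(`AggregateData.Describes.isSolution`). -/

/-- The polyhedron of the nonnegative solutions of the inequalities `A x ≤ b` with integer
coefficients, where the inequalities with index in `Q` are required to be equalities. -/
def rationalPolyhedron {ι R : Type*} [Fintype ι] (A : R → ι → ℤ) (b : R → ℤ) (Q : Set R) :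
    Set (ι → ℝ) :=
  {x | (∀ i, 0 ≤ x i) ∧ ∀ r, (∑ i, (A r i : ℝ) * x i ≤ b r) ∧
    (r ∈ Q → ∑ i, (A r i : ℝ) * x i = b r)}

/-- A common denominator of the coordinates of the extreme points of all polyhedra in `n` variables
with `r` inequalities whose coefficients are bounded by `h`. -/
def commonDenominator (n r h : ℕ) : ℕ := (n.factorial * ((n + r) * h ^ 2) ^ n).factorial

theorem commonDenominator_pos (n r h : ℕ) : 0 < commonDenominator n r h := Nat.factorial_pos _

/-! ### Polyhedra and the denominators of their extreme points -/

section Polyhedron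

variable {ι R : Type*} [Fintype ι] {A : R → ι → ℤ} {b : R → ℤ} {Q : Set R}

theorem isClosed_rationalPolyhedron : IsClosed (rationalPolyhedron A b Q) := by
  have : rationalPolyhedron A b Q = (⋂ i, {x | 0 ≤ x i}) ∩
      ⋂ r, ({x | ∑ i, (A r i : ℝ) * x i ≤ b r} ∩
        {x | r ∈ Q → ∑ i, (A r i : ℝ) * x i = b r}) := by
    ext x; simp [rationalPolyhedron]
  rw [this]
  refine (isClosed_iInter fun i => isClosed_le (by fun_prop) (by fun_prop)).inter
    (isClosed_iInter fun r => (isClosed_le (by fun_prop) (by fun_prop)).inter ?_)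
  by_cases h : r ∈ Q
  · simpa [h] using isClosed_eq (f := fun x : ι → ℝ => ∑ i, (A r i : ℝ) * x i)
      (g := fun _ => (b r : ℝ)) (by fun_prop) (by fun_prop)
  · simp [h]

theorem convex_rationalPolyhedron : Convex ℝ (rationalPolyhedron A b Q) := by
  intro x hx y hy s t hs ht hst
  have key : ∀ r, ∑ i, (A r i : ℝ) * (s • x + t • y) i =
      s * ∑ i, (A r i : ℝ) * x i + t * ∑ i, (A r i : ℝ) * y i := by
    intro r
    rw [Finset.mul_sum, Finset.mul_sum, ← Finset.sum_add_distrib]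
    refine Finset.sum_congr rfl fun i _ => ?_
    simp only [Pi.add_apply, Pi.smul_apply, smul_eq_mul]; ring
  have hb : ∀ r, s * (b r : ℝ) + t * b r = b r := fun r => by rw [← add_mul, hst, one_mul]
  refine ⟨fun i => ?_, fun r => ⟨?_, fun hr => ?_⟩⟩
  · have := hx.1 i; have := hy.1 i
    simp only [Pi.add_apply, Pi.smul_apply, smul_eq_mul]; positivity
  · rw [key, ← hb r]
    exact add_le_add (mul_le_mul_of_nonneg_left (hx.2 r).1 hs)
      (mul_le_mul_of_nonneg_left (hy.2 r).1 ht)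
  · rw [key, (hx.2 r).2 hr, (hy.2 r).2 hr, hb]

theorem isCompact_rationalPolyhedron (B : ι → ℝ)
    (hB : ∀ x ∈ rationalPolyhedron A b Q, ∀ i, x i ≤ B i) :
    IsCompact (rationalPolyhedron A b Q) :=
  (isCompact_Icc (a := (0 : ι → ℝ)) (b := B)).of_isClosed_subset isClosed_rationalPolyhedron
    fun x hx => ⟨hx.1, hB x hx⟩

/-- At an extreme point of a polyhedron the tight constraints determine the point. -/
theorem eq_zero_of_tight [Finite R] {x : ι → ℝ}
    (hx : x ∈ Set.extremePoints ℝ (rationalPolyhedron A b Q)) {v : ι → ℝ}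
    (h0 : ∀ i, x i = 0 → v i = 0)
    (h1 : ∀ r, ∑ i, (A r i : ℝ) * x i = b r → ∑ i, (A r i : ℝ) * v i = 0) : v = 0 := by
  -- Along `v` the tight constraints stay tight, and the others have slack that survives a small
  -- step. Applied to `v` and `-v`, this makes `x` the midpoint of two points of the polyhedron.
  have key : ∀ v : ι → ℝ, (∀ i, x i = 0 → v i = 0) →
      (∀ r, ∑ i, (A r i : ℝ) * x i = b r → ∑ i, (A r i : ℝ) * v i = 0) →
      ∀ᶠ ε : ℝ in nhdsWithin 0 (Set.Ioi 0), x + ε • v ∈ rationalPolyhedron A b Q := by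
    intro v h0 h1
    refine Filter.Eventually.filter_mono nhdsWithin_le_nhds ?_
    have hs : ∀ (r) (ε : ℝ), ∑ i, (A r i : ℝ) * (x + ε • v) i =
        ∑ i, (A r i : ℝ) * x i + ε * ∑ i, (A r i : ℝ) * v i := by
      intro r ε
      rw [Finset.mul_sum, ← Finset.sum_add_distrib]
      refine Finset.sum_congr rfl fun i _ => ?_
      simp only [Pi.add_apply, Pi.smul_apply, smul_eq_mul]; ring
    refine Filter.Eventually.and (Filter.eventually_all.2 fun i => ?_)
      (Filter.eventually_all.2 fun r => ?_)
    · rcases (hx.1.1 i).eq_or_lt with h | h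
      · simp [← h, h0 i h.symm]
      · have hc : Continuous fun ε : ℝ => (x + ε • v) i := by
          simp only [Pi.add_apply, Pi.smul_apply, smul_eq_mul]; fun_prop
        have := hc.tendsto 0
        simp only [zero_smul, add_zero] at this
        exact (this.eventually (lt_mem_nhds h)).mono fun ε => le_of_lt
    · simp only [hs]
      rcases (hx.1.2 r).1.eq_or_lt with h | h
      · simp [h1 r h, h]
      · have hc : Continuous fun ε : ℝ =>
            ∑ i, (A r i : ℝ) * x i + ε * ∑ i, (A r i : ℝ) * v i := by fun_prop
        have := hc.tendsto 0
        simp only [zero_mul, add_zero] at this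
        exact (this.eventually (gt_mem_nhds h)).mono fun ε hε =>
          ⟨hε.le, fun hr => absurd ((hx.1.2 r).2 hr) h.ne⟩
  obtain ⟨ε, ⟨hp, hn⟩, hε⟩ := ((key v h0 h1).and (key (-v) (fun i hi => by simp [h0 i hi])
    (fun r hr => by simp [h1 r hr]))).and self_mem_nhdsWithin |>.exists
  have hε' : (0 : ℝ) < ε := hε
  have hmem : x ∈ openSegment ℝ (x + ε • v) (x + ε • (-v)) :=
    ⟨1 / 2, 1 / 2, by norm_num, by norm_num, by norm_num, by
      ext i; simp only [Pi.add_apply, Pi.smul_apply, smul_eq_mul, Pi.neg_apply]; ring⟩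
  have := hx.2 hp hn hmem
  have h : ε • v = 0 := by simpa using this
  exact (smul_eq_zero.1 h).resolve_left hε'.ne'

/-- Cramer's rule for the tight constraints `B x = c`. As `B` need not be square, it is replaced by
its Gram matrix, which is invertible because the tight constraints determine `x`. The denominator
depends neither on `x` nor on `b`. -/
theorem exists_int_of_mem_extremePoints [Fintype R] {x : ι → ℝ}
    (hx : x ∈ Set.extremePoints ℝ (rationalPolyhedron A b Q)) {h : ℕ} (h1 : 1 ≤ h)
    (hA : ∀ r i, |A r i| ≤ h) (i : ι) :
    ∃ z : ℤ, (commonDenominator (Fintype.card ι) (Fintype.card R) h : ℝ) * x i = z := by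
  classical
  -- Rows of constraints that are not tight are set to zero instead of being removed, so that the
  -- index type does not depend on `x`. The rows for `x i = 0` contain a 1, whence `1 ≤ h`.
  obtain ⟨B, hBl, hBr⟩ : ∃ B : Matrix (ι ⊕ R) ι ℤ,
      (∀ i j, B (Sum.inl i) j = if x i = 0 ∧ i = j then 1 else 0) ∧
      ∀ r j, B (Sum.inr r) j = if ∑ i, (A r i : ℝ) * x i = b r then A r j else 0 :=
    ⟨fun s j => s.elim (fun i => if x i = 0 ∧ i = j then 1 else 0)
      (fun r => if ∑ i, (A r i : ℝ) * x i = b r then A r j else 0), fun _ _ => rfl, fun _ _ => rfl⟩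
  obtain ⟨c, hcl, hcr⟩ : ∃ c : ι ⊕ R → ℤ, (∀ i, c (Sum.inl i) = 0) ∧
      ∀ r, c (Sum.inr r) = if ∑ i, (A r i : ℝ) * x i = b r then b r else 0 :=
    ⟨fun s => s.elim (fun _ => 0)
      (fun r => if ∑ i, (A r i : ℝ) * x i = b r then b r else 0), fun _ => rfl, fun _ => rfl⟩
  let f : ℤ →+* ℝ := Int.castRingHom ℝ
  let G : Matrix ι ι ℤ := B.transpose * B
  have hBx : (B.map f).mulVec x = fun s => (c s : ℝ) := by
    funext s
    rcases s with i | r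
    · simp only [Matrix.mulVec, dotProduct, Matrix.map_apply, hBl, hcl]
      refine (Finset.sum_eq_zero fun j _ => ?_).trans (by simp)
      split_ifs with hj
      · rw [← hj.2, hj.1, mul_zero]
      · simp
    · simp only [Matrix.mulVec, dotProduct, Matrix.map_apply, hBr, hcr]
      split_ifs with hr
      · simpa [f] using hr
      · simp
  -- A kernel vector `v` of `BᵀB` satisfies `‖B v‖² = 0`, so it annihilates all tight constraints.
  have hdet : G.det ≠ 0 := by
    intro h0
    have : (G.map f).det = 0 := by
      have := RingHom.map_det f G
      rw [h0, map_zero] at this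
      exact this.symm
    obtain ⟨v, hv, hGv⟩ := Matrix.exists_mulVec_eq_zero_iff.2 this
    have hBv : (B.map f).mulVec v = 0 := by
      have hG : G.map f = (B.map f).transpose * B.map f := by
        simp [G, Matrix.map_mul, Matrix.transpose_map]
      have hz : dotProduct ((B.map f).mulVec v) ((B.map f).mulVec v) = 0 := by
        have : dotProduct v ((G.map f).mulVec v) = 0 := by rw [hGv, dotProduct_zero]
        rw [hG, ← Matrix.mulVec_mulVec, Matrix.dotProduct_mulVec, Matrix.vecMul_transpose] at this
        exact this
      exact dotProduct_self_eq_zero.1 hz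
    refine hv (eq_zero_of_tight hx (fun i hi => ?_) fun r hr => ?_)
    · have := congrFun hBv (Sum.inl i)
      simpa [Matrix.mulVec, dotProduct, hBl, hi, apply_ite] using this
    · have := congrFun hBv (Sum.inr r)
      simpa [Matrix.mulVec, dotProduct, hBr, hr, f] using this
  have hBabs : ∀ s j, |B s j| ≤ h := by
    rintro (i | r) j
    · rw [hBl]
      split_ifs
      · simpa using h1
      · simp
    · rw [hBr]
      split_ifs
      · exact hA r j
      · simp
  have hG : ∀ i j, |G i j| ≤ ((Fintype.card ι + Fintype.card R) * h ^ 2 : ℕ) := by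
    intro i j
    calc |G i j| ≤ ∑ s, |B s i * B s j| := by
          simp only [G, Matrix.mul_apply, Matrix.transpose_apply]
          exact Finset.abs_sum_le_sum_abs _ _
      _ ≤ ∑ _s : ι ⊕ R, (h : ℤ) ^ 2 := by
          refine Finset.sum_le_sum fun s _ => ?_
          rw [abs_mul, sq]
          exact mul_le_mul (hBabs s i) (hBabs s j) (abs_nonneg _) (by positivity)
      _ = _ := by simp
  have hle := Matrix.det_le (abv := AbsoluteValue.abs) hG
  simp only [AbsoluteValue.abs_apply, nsmul_eq_mul] at hle
  -- A nonzero integer of absolute value at most `K` divides `K!`; here `K` is the Leibniz bound for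
  -- `det G`.
  have hdvd : G.det ∣ (commonDenominator (Fintype.card ι) (Fintype.card R) h : ℤ) := by
    rw [← Int.natAbs_dvd_natAbs, Int.natAbs_natCast]
    refine Nat.dvd_factorial (Int.natAbs_pos.2 hdet) ?_
    zify
    refine hle.trans (le_of_eq ?_)
    push_cast
    ring
  obtain ⟨d, hd⟩ := hdvd
  have hdx : (G.det : ℝ) * x i = (((G.adjugate * B.transpose).mulVec c i : ℤ) : ℝ) := by
    have e1 : ((G.adjugate * G).map f).mulVec x =
        ((G.adjugate * B.transpose).map f).mulVec (fun s => (c s : ℝ)) := by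
      rw [← hBx]
      simp only [G, Matrix.mulVec_mulVec, ← Matrix.map_mul, Matrix.mul_assoc]
    rw [Matrix.adjugate_mul] at e1
    have e2 := congrFun e1 i
    simp only [Matrix.mulVec, dotProduct, Matrix.map_apply, Matrix.smul_apply, Matrix.one_apply,
      smul_eq_mul] at e2 ⊢
    rw [Finset.sum_eq_single i (by intro j _ hj; simp [hj.symm]) (by simp)] at e2
    simpa [f] using e2
  refine ⟨d * (G.adjugate * B.transpose).mulVec c i, ?_⟩
  have : (commonDenominator (Fintype.card ι) (Fintype.card R) h : ℝ) = d * G.det := by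
    rw [mul_comm]; exact_mod_cast hd
  rw [this, mul_assoc, hdx]; push_cast; ring

theorem exists_nat_of_mem_extremePoints [Fintype R] {x : ι → ℝ}
    (hx : x ∈ Set.extremePoints ℝ (rationalPolyhedron A b Q)) {h : ℕ} (h1 : 1 ≤ h)
    (hA : ∀ r i, |A r i| ≤ h) :
    ∃ y : ι → ℕ, ∀ i,
      (commonDenominator (Fintype.card ι) (Fintype.card R) h : ℝ) * x i = y i := by
  have : ∀ i, ∃ y : ℕ,
      (commonDenominator (Fintype.card ι) (Fintype.card R) h : ℝ) * x i = y := by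
    intro i
    obtain ⟨z, hz⟩ := exists_int_of_mem_extremePoints hx h1 hA i
    have : 0 ≤ z := by
      have := hx.1.1 i
      have : (0 : ℝ) ≤ z := hz ▸ by positivity
      exact_mod_cast this
    lift z to ℕ using this
    exact ⟨z, by simpa using hz⟩
  choose y hy using this
  exact ⟨y, hy⟩

end Polyhedron

/-- A compact convex set with finitely many extreme points is their convex hull. -/
theorem convexHull_extremePoints_eq {ι : Type*} {X : Set (ι → ℝ)} (hX : IsCompact X)
    (hc : Convex ℝ X) (hf : (X.extremePoints ℝ).Finite) :
    convexHull ℝ (X.extremePoints ℝ) = X := by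
  rw [← hf.isClosed_convexHull ℝ |>.closure_eq]
  exact closure_convexHull_extremePoints hX hc

theorem IsLinearMap.map_sum_smul {F A B ι : Type*} [Field F] [AddCommGroup A] [Module F A]
    [AddCommGroup B] [Module F B] {f : A → B} (hf : IsLinearMap F f) (s : Finset ι) (c : ι → F)
    (v : ι → A) : f (∑ i ∈ s, c i • v i) = ∑ i ∈ s, c i • f (v i) := by
  exact (map_sum (IsLinearMap.mk' f hf) (fun i => c i • v i) s).trans
    (Finset.sum_congr rfl fun i _ => hf.map_smul _ _)

/-! ### A linear-algebraic criterion for partial solutions -/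

namespace CapacitatedNetwork

open Matrix

variable {V E M : Type*} (N : CapacitatedNetwork V E M) {F : Type*} [Field F]

variable (F) in
/-- There is a partial scalar-linear solution with weight vector `w` that uses only edges in `S`. -/
def PartialFeasible (w : M → Bool) (S : Set E) : Prop :=
  ∃ C : N.PartialScalarCode F w, C.IsLinear ∧ C.IsSolution ∧ ∀ e, C.Uses e → e ∈ S

/-- If the edge `e` carries the linear form `g e` of the messages, then the node `x` sees only
zeros for the message assignment `a`. -/
def VanishesAt [Fintype M] (g : E → M → F) (x : V) (a : M → F) : Prop :=
  (∀ m ∈ N.source x, a m = 0) ∧ ∀ e, N.head e = x → g e ⬝ᵥ a = 0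

/-- The edges can carry the linear forms `g e` of the messages selected by `w`, only edges in `S`
carry a nonzero form, and all demands for selected messages can be met. -/
structure IsKernelSolution [Fintype M] (w : M → Bool) (S : Set E) (g : E → M → F) : Prop where
  unused : ∀ e, e ∉ S → ∀ a : M → F, (∀ m, w m = false → a m = 0) → g e ⬝ᵥ a = 0
  edge : ∀ e, ∀ a : M → F, (∀ m, w m = false → a m = 0) → N.VanishesAt g (N.tail e) a →
    g e ⬝ᵥ a = 0
  dec : ∀ x, ∀ m ∈ N.receiver x, w m = true → ∀ a : M → F, (∀ m, w m = false → a m = 0) →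
    N.VanishesAt g x a → a m = 0

variable {N} {w : M → Bool} {S : Set E}

instance subsingleton_edgeIndex (e : E) : Subsingleton (Fin (1 * (N.restrict w).cap e)) :=
  inferInstanceAs (Subsingleton (Fin 1))

/-- The coefficients of `g` are the edge values for the unit message assignments. By linearity,
superpositions of these edge values again obey the code and decode correctly, so uniqueness of the
edge values is not needed. If a node sees only zeros, linear functions of its input vanish. -/
theorem PartialFeasible.exists_isKernelSolution [Fintype M] (h : N.PartialFeasible F w S) :
    ∃ g : E → M → F, N.IsKernelSolution w S g := by
  classical
  obtain ⟨C, ⟨hle, hld⟩, hsol, hS⟩ := h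
  let i0 : ∀ e, Fin (1 * (N.restrict w).cap e) := fun e => (⟨0, Nat.one_pos⟩ : Fin 1)
  let δ : {m // w m = true} → ({m // w m = true} → Fin 1 → F) := fun m m' _ =>
    if m' = m then 1 else 0
  choose s hs hd using fun m => hsol (δ m)
  let g : E → M → F := fun e m => if h : w m = true then s ⟨m, h⟩ e (i0 e) else 0
  let σ : (M → F) → ∀ e, Fin (1 * (N.restrict w).cap e) → F := fun a =>
    ∑ m : {m // w m = true}, a m • s m
  have hg : ∀ e (a : M → F), (∀ m, w m = false → a m = 0) → ∀ i, σ a e i = g e ⬝ᵥ a := by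
    intro e a ha i
    obtain rfl := Subsingleton.elim i (i0 e)
    simp only [σ, dotProduct, Finset.sum_apply, Pi.smul_apply, smul_eq_mul]
    rw [← Fintype.sum_subtype_add_sum_subtype (fun m => w m = true) (fun m => g e m * a m)]
    rw [Finset.sum_eq_zero (s := (Finset.univ : Finset {m // ¬ w m = true})), add_zero]
    · refine Finset.sum_congr rfl fun m _ => ?_
      simp only [g, m.2, dite_true, mul_comm]
    · intro m _
      rw [ha m (by simpa using m.2), mul_zero]
  let â : (M → F) → {m // w m = true} → Fin 1 → F := fun a m _ => a m
  have hin : ∀ (a : M → F) x, (N.restrict w).inputAt (â a) (σ a) x =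
      ∑ m : {m // w m = true}, a m • (N.restrict w).inputAt (δ m) (s m) x := by
    intro a x
    refine Prod.ext ?_ ?_
    · funext m i
      simp [inputAt, â, δ, Prod.fst_sum, Finset.sum_apply]
    · funext e i
      simp [inputAt, σ, Prod.snd_sum, Finset.sum_apply]
  have hσ : ∀ (a : M → F) e, σ a e =
      C.edgeFun e ((N.restrict w).inputAt (â a) (σ a) ((N.restrict w).tail e)) := by
    intro a e
    rw [hin, (hle e).map_sum_smul]
    simp only [σ, Finset.sum_apply, Pi.smul_apply]
    exact Finset.sum_congr rfl fun m _ => by rw [← hs m e]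
  have hδ : ∀ (a : M → F) x (m : {m // m ∈ (N.restrict w).receiver x}),
      C.decFun x m ((N.restrict w).inputAt (â a) (σ a) x) = â a m.1 := by
    intro a x m
    rw [hin, (hld x m).map_sum_smul]
    simp only [hd]
    funext i
    simp [δ, â, Finset.sum_apply]
  have hzero : ∀ (a : M → F) x, (∀ m, w m = false → a m = 0) → N.VanishesAt g x a →
      (N.restrict w).inputAt (â a) (σ a) x = 0 := by
    intro a x ha hv
    refine Prod.ext ?_ ?_
    · funext m i
      exact hv.1 _ (Finset.mem_subtype.1 m.2)
    · funext e i
      exact (hg _ a ha i).trans (hv.2 _ e.2)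
  refine ⟨g, ⟨fun e he a ha => ?_, fun e a ha hv => ?_, fun x m hm hw a ha hv => ?_⟩⟩
  · rw [← hg e a ha (i0 e), hσ]
    by_contra h
    exact he (hS e ⟨_, fun h0 => h (congrFun h0 _)⟩)
  · rw [← hg e a ha (i0 e), hσ]
    rw [hzero a ((N.restrict w).tail e) ha hv, (hle e).map_zero]
    rfl
  · have := hδ a x ⟨⟨m, hw⟩, Finset.mem_subtype.2 hm⟩
    rw [hzero a x ha hv, (hld x _).map_zero] at this
    exact (congrFun this 0).symm

/-- A linear map that vanishes on the kernel of another one factors through it. -/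
theorem exists_factor_of_ker_le {A B : Type*} [AddCommGroup A] [Module F A] [AddCommGroup B]
    [Module F B] (I : A →ₗ[F] B) (φ : A →ₗ[F] F) (h : ∀ a, I a = 0 → φ a = 0) :
    ∃ ψ : B →ₗ[F] F, ∀ a, ψ (I a) = φ a := by
  have : φ ∈ LinearMap.range I.dualMap := by
    rw [LinearMap.range_dualMap_eq_dualAnnihilator_ker, Submodule.mem_dualAnnihilator]
    exact fun a ha => h a ha
  obtain ⟨ψ, hψ⟩ := this
  exact ⟨ψ, fun a => LinearMap.congr_fun hψ a⟩

/-- The kernel conditions say that each edge form, and each demanded coordinate, vanishes wherever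
the input of the node does; hence it factors linearly through that input. The factors are the edge
and decoding functions. -/
theorem IsKernelSolution.partialFeasible [Fintype M] {g : E → M → F}
    (h : N.IsKernelSolution w S g) : N.PartialFeasible F w S := by
  classical
  let ext : ({m // w m = true} → F) → M → F := fun a m => if h : w m = true then a ⟨m, h⟩ else 0
  have hext : ∀ a m, w m = false → ext a m = 0 := fun a m hm => by simp [ext, hm]
  have hextv : ∀ a (m : {m // w m = true}), ext a m = a m := fun a m => by
    simp [ext, m.2]
  have hext_add : ∀ a b, ext (a + b) = ext a + ext b := fun a b => by
    funext m; by_cases hm : w m = true <;> simp [ext, hm]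
  have hext_smul : ∀ (c : F) a, ext (c • a) = c • ext a := fun c a => by
    funext m; by_cases hm : w m = true <;> simp [ext, hm]
  let gl : E → ({m // w m = true} → F) →ₗ[F] F := fun e =>
    { toFun := fun a => g e ⬝ᵥ ext a
      map_add' := fun a b => by rw [hext_add, dotProduct_add]
      map_smul' := fun c a => by simp [hext_smul] }
  let I : ∀ x, ({m // w m = true} → F) →ₗ[F] (N.restrict w).NodeInput F (fun _ => 1) 1 x := fun x =>
    { toFun := fun a => (N.restrict w).inputAt (fun m _ => a m) (fun e _ => gl e a) x
      map_add' := fun a b => by simp only [map_add]; rfl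
      map_smul' := fun c a => by simp only [map_smul]; rfl }
  have hI : ∀ x a, I x a = 0 → N.VanishesAt g x (ext a) := by
    intro x a ha
    refine ⟨fun m hm => ?_, fun e he => ?_⟩
    · by_cases hw : w m = true
      · have := congrFun (congrFun (congrArg Prod.fst ha) ⟨⟨m, hw⟩, Finset.mem_subtype.2 hm⟩) 0
        rw [hextv a ⟨m, hw⟩]
        exact this
      · exact hext a m (by simpa using hw)
    · exact congrFun (congrFun (congrArg Prod.snd ha) ⟨e, he⟩) (⟨0, Nat.one_pos⟩ : Fin 1)
  have hedge : ∀ e, ∃ ψ : (N.restrict w).NodeInput F (fun _ => 1) 1 (N.tail e) →ₗ[F] F,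
      (∀ a, ψ (I _ a) = gl e a) ∧ (e ∉ S → ψ = 0) := by
    intro e
    by_cases he : e ∈ S
    · obtain ⟨ψ, hψ⟩ := exists_factor_of_ker_le (I (N.tail e)) (gl e)
        (fun a ha => h.edge e _ (hext a) (hI _ a ha))
      exact ⟨ψ, hψ, fun h => absurd he h⟩
    -- Any factor would reproduce the form on actual inputs, but the edge must remain unused on all
    -- inputs, so the zero functional is taken.
    · exact ⟨0, fun a => (h.unused e he _ (hext a)).symm, fun _ => rfl⟩
  have hdec : ∀ x (m : {m // m ∈ (N.restrict w).receiver x}),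
      ∃ ψ : (N.restrict w).NodeInput F (fun _ => 1) 1 x →ₗ[F] F, ∀ a, ψ (I _ a) = a m.1 := by
    intro x m
    refine exists_factor_of_ker_le (I x) (LinearMap.proj m.1) fun a ha => ?_
    have := h.dec x m.1 (Finset.mem_subtype.1 m.2) m.1.2 _ (hext a) (hI _ a ha)
    rwa [hextv] at this
  choose ψ hψ hψ0 using hedge
  choose η hη using hdec
  refine ⟨⟨fun e u _ => ψ e u, fun x m u _ => η x m u⟩, ⟨fun e => ⟨fun u v => ?_, fun c u => ?_⟩,
    fun x m => ⟨fun u v => ?_, fun c u => ?_⟩⟩, fun a => ⟨fun e _ => gl e fun m => a m 0,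
      fun e => ?_, fun x m => ?_⟩, fun e he => ?_⟩
  · funext _; exact map_add _ _ _
  · funext _; exact map_smul _ _ _
  · funext _; exact map_add _ _ _
  · funext _; exact map_smul _ _ _
  · have ha : a = fun m _ => a m 0 := by
      funext m i; rw [Subsingleton.elim i 0]
    funext i
    refine (hψ e fun m => a m 0).symm.trans ?_
    nth_rewrite 2 [ha]
    rfl
  · have ha : a = fun m _ => a m 0 := by
      funext m i; rw [Subsingleton.elim i 0]
    funext i
    refine Eq.trans ?_ ((hη x m fun m => a m 0).trans (by rw [Subsingleton.elim i 0]))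
    nth_rewrite 1 [ha]
    rfl
  · by_contra hS
    obtain ⟨u, hu⟩ := he
    refine hu ?_
    funext i
    simp only [hψ0 e hS]
    rfl

theorem partialFeasible_iff [Fintype M] :
    N.PartialFeasible F w S ↔ ∃ g : E → M → F, N.IsKernelSolution w S g :=
  ⟨fun h => h.exists_isKernelSolution, fun ⟨_, h⟩ => h.partialFeasible⟩

/-- In a non-degenerate network every single message can be sent by flooding. -/
theorem NonDegenerate.partialFeasible_single [Fintype M] [DecidableEq M] (hN : N.NonDegenerate)
    (m : M) : N.PartialFeasible F (fun m' => decide (m' = m)) Set.univ := by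
  classical
  -- Every edge leaving a node reachable from a source of `m` carries `m`. Such a node either
  -- generates `m` or receives it on the last edge of a path.
  let reach : V → Prop := fun x => ∃ y, m ∈ N.source y ∧
    Relation.ReflTransGen (fun y z => ∃ e, N.tail e = y ∧ N.head e = z) y x
  let g : E → M → F := fun e => if reach (N.tail e) then Pi.single m 1 else 0
  have key : ∀ x a, reach x → N.VanishesAt g x a → a m = 0 := by
    rintro x a ⟨y, hy, hyx⟩ hv
    rcases Relation.ReflTransGen.cases_tail hyx with rfl | ⟨z, hyz, e, rfl, rfl⟩
    · exact hv.1 m hy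
    · have hr : reach (N.tail e) := ⟨y, hy, hyz⟩
      simpa [g, hr] using hv.2 e rfl
  refine IsKernelSolution.partialFeasible (g := g) ⟨fun e he => absurd (Set.mem_univ e) he,
    fun e a _ hv => ?_, fun x m' hm' hw a _ hv => ?_⟩
  · by_cases hr : reach (N.tail e)
    · simpa [g, hr] using key _ a hr hv
    · simp [g, hr]
  · obtain rfl : m' = m := by simpa using hw
    exact key x a (hN.path x m' hm') hv

/-- In a non-degenerate network nothing can be sent without using an edge. -/
theorem PartialFeasible.nonempty [Finite M] (hN : N.NonDegenerate)
    (h : N.PartialFeasible F w S) {m : M} (hm : w m = true) : S.Nonempty := by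
  classical
  cases nonempty_fintype M
  obtain ⟨g, hg⟩ := h.exists_isKernelSolution
  by_contra hS
  rw [Set.not_nonempty_iff_eq_empty] at hS
  obtain ⟨x, hx⟩ := hN.demanded m
  -- The assignment with a single 1 at `m` is invisible to a demanding node: the node does not
  -- generate `m`, and all edges carry zero.
  have ha : ∀ m', w m' = false → (Pi.single m 1 : M → F) m' = 0 := by
    intro m' hm'
    refine Pi.single_eq_of_ne ?_ _
    rintro rfl
    simp [hm] at hm'
  have := hg.dec x m hx hm (Pi.single m 1) ha
    ⟨fun m' hm' => Pi.single_eq_of_ne (by rintro rfl; exact hN.disjoint x _ hm' hx) _,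
      fun e _ => hg.unused e (by simp [hS]) _ ha⟩
  simp at this

end CapacitatedNetwork

/-! ### Aggregates and their multiplicities -/

namespace CapacitatedNetwork

variable {V E M : Type*} {N : CapacitatedNetwork V E M} {F : Type*} [Field F]

namespace AggregateData

variable {k : M → ℕ} {n : ℕ} (D : N.AggregateData F k n)

theorem share_add (j : Fin D.r) {x : V} (u v : N.NodeInput F k n x) :
    D.share j (u + v) = D.share j u + D.share j v := by
  refine Prod.ext rfl ?_
  funext e i
  by_cases h : (D.part j).Uses e.1 <;> simp [share, h]

theorem share_smul (j : Fin D.r) {x : V} (c : F) (u : N.NodeInput F k n x) :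
    D.share j (c • u) = c • D.share j u := by
  refine Prod.ext rfl ?_
  funext e i
  by_cases h : (D.part j).Uses e.1 <;> simp [share, h]

open Classical in
/-- The code that puts the partial solutions side by side. -/
noncomputable def code : N.FractionalCode F k n where
  edgeFun e u c :=
    if h : ∃ j, D.edgeCoord e j = c then
      (D.part h.choose.1).edgeFun e (D.share h.choose.1 u) (⟨0, Nat.one_pos⟩ : Fin 1)
    else 0
  decFun x m u i :=
    (D.part ((D.msgCoord m.1).symm i).1).decFun x
      ⟨⟨m.1, ((D.msgCoord m.1).symm i).2⟩, Finset.mem_subtype.2 m.2⟩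
      (D.share ((D.msgCoord m.1).symm i).1 u) 0

theorem describes_code : D.Describes D.code where
  edge e u j i := by
    have h : ∃ j', D.edgeCoord e j' = D.edgeCoord e j := ⟨j, rfl⟩
    have hj : h.choose = j := (D.edgeCoord e).injective h.choose_spec
    have hi : ∀ j' : {j // (D.part j).Uses e}, j' = j →
        (D.part j'.1).edgeFun e (D.share j'.1 u) (⟨0, Nat.one_pos⟩ : Fin 1) =
          (D.part j.1).edgeFun e (D.share j.1 u) i := by
      rintro _ rfl
      exact congrArg _ (Subsingleton.elim (α := Fin 1) _ _)
    exact (dif_pos h).trans (hi _ hj)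
  edge_inactive e u c hc := dif_neg fun ⟨j, hj⟩ => hc ⟨j, hj⟩
  dec x m u j i := by
    have hi : ∀ j' : {j // D.weight j m.1 = true}, j' = j →
        (D.part j'.1).decFun x ⟨⟨m.1, j'.2⟩, Finset.mem_subtype.2 m.2⟩ (D.share j'.1 u) 0 =
          (D.part j.1).decFun x ⟨⟨m.1, j.2⟩, Finset.mem_subtype.2 m.2⟩ (D.share j.1 u) i := by
      rintro _ rfl
      exact congrArg _ (Subsingleton.elim (α := Fin 1) _ _)
    exact hi _ (Equiv.symm_apply_apply _ _)

theorem code_isLinear : D.code.IsLinear := by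
  refine ⟨fun e => ⟨fun u v => ?_, fun c u => ?_⟩, fun x m => ⟨fun u v => ?_, fun c u => ?_⟩⟩
  · funext i
    by_cases h : ∃ j, D.edgeCoord e j = i
    · simp only [code, dif_pos h, Pi.add_apply]
      exact (congrFun (congrArg ((D.part _).edgeFun e) (D.share_add _ u v)) _).trans
        (congrFun (((D.part_linear _).1 e).map_add _ _) _)
    · simp [code, dif_neg h]
  · funext i
    by_cases h : ∃ j, D.edgeCoord e j = i
    · simp only [code, dif_pos h, Pi.smul_apply]
      exact (congrFun (congrArg ((D.part _).edgeFun e) (D.share_smul _ c u)) _).trans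
        (congrFun (((D.part_linear _).1 e).map_smul _ _) _)
    · simp [code, dif_neg h]
  · funext i
    simp only [code, Pi.add_apply]
    rw [share_add]
    exact congrFun (((D.part_linear _).2 x _).map_add _ _) _
  · funext i
    simp only [code, Pi.smul_apply]
    rw [share_smul]
    exact congrFun (((D.part_linear _).2 x _).map_smul _ _) _

/-- The edge values of the parts are written into their own coordinates. Each part then sees exactly
its own input; on an edge it does not use, its value is zero, which agrees with the zero supplied by
`share`. -/
theorem Describes.isSolution {D : N.AggregateData F k n} {C : N.FractionalCode F k n}
    (h : D.Describes C) : C.IsSolution := by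
  classical
  intro a
  choose s hs hd using fun j => D.part_solution j fun m _ => a m.1 (D.msgCoord m.1 ⟨j, m.2⟩)
  let t : ∀ e, Fin (n * N.cap e) → F := fun e c =>
    if h : ∃ j, D.edgeCoord e j = c then s h.choose.1 e (⟨0, Nat.one_pos⟩ : Fin 1) else 0
  have ht : ∀ e j i, t e (D.edgeCoord e j) = s j.1 e i := by
    intro e j i
    have h : ∃ j', D.edgeCoord e j' = D.edgeCoord e j := ⟨j, rfl⟩
    have hj : h.choose = j := (D.edgeCoord e).injective h.choose_spec
    refine (dif_pos h).trans ?_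
    rw [hj]
    exact congrArg _ (Subsingleton.elim (α := Fin 1) _ _)
  have hshare : ∀ j x, D.share j (N.inputAt a t x) = (N.restrict (D.weight j)).inputAt
      (fun m _ => a m.1 (D.msgCoord m.1 ⟨j, m.2⟩)) (s j) x := by
    intro j x
    refine Prod.ext rfl ?_
    funext e i
    by_cases hu : (D.part j).Uses e.1
    · simpa [share, hu, inputAt] using ht e.1 ⟨j, hu⟩ i
    · have : s j e.1 = 0 := by
        rw [hs]
        by_contra hne
        exact hu ⟨_, hne⟩
      simp [share, hu, inputAt, this]
  refine ⟨t, fun e => ?_, fun x m => ?_⟩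
  · funext c
    by_cases hc : c ∈ Set.range (D.edgeCoord e)
    · obtain ⟨j, rfl⟩ := hc
      have i : Fin (1 * (N.restrict (D.weight j.1)).cap e) := (⟨0, Nat.one_pos⟩ : Fin 1)
      rw [h.edge e _ j i, ht e j i, hs j.1 e]
      exact congrFun (congrArg ((D.part j.1).edgeFun e) (hshare j.1 (N.tail e)).symm) i
    · rw [h.edge_inactive e _ c hc]
      exact dif_neg fun ⟨j, hj⟩ => hc ⟨j, hj⟩
  · funext i
    obtain ⟨j, rfl⟩ := (D.msgCoord m.1).surjective i
    rw [h.dec x m _ j 0, hshare, hd]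

end AggregateData

variable (N F) in
/-- The family `p` lists, as 0-1 vectors, the nonzero weight vectors together with the edge sets
for which there is a partial scalar-linear solution. -/
structure IsFeasibleFamily {ι : Type*} (p : ι → (M → ℕ) × (E → ℕ)) : Prop where
  msg_le_one : ∀ i m, (p i).1 m ≤ 1
  edge_le_one : ∀ i e, (p i).2 e ≤ 1
  feasible : ∀ i, N.PartialFeasible F (fun m => decide ((p i).1 m = 1)) {e | (p i).2 e = 1}
  ne_zero : ∀ i, ∃ m, (p i).1 m = 1
  complete : ∀ (w : M → Bool) (S : E → Bool), N.PartialFeasible F w {e | S e = true} →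
    (∃ m, w m = true) → ∃ i, p i = (fun m => (w m).toNat, fun e => (S e).toNat)

theorem card_subtype_sigma {ι : Type*} [Fintype ι] (c : ι → ℕ) (f : ι → ℕ) (hf : ∀ i, f i ≤ 1)
    {r : ℕ} (φ : Fin r ≃ Σ i, Fin (c i)) :
    Fintype.card {j : Fin r // f (φ j).1 = 1} = ∑ i, c i * f i := by
  classical
  rw [Fintype.card_congr (φ.subtypeEquiv (q := fun x => f x.1 = 1) fun _ => Iff.rfl),
    Fintype.card_subtype, Finset.card_filter, Fintype.sum_sigma]
  refine Finset.sum_congr rfl fun i _ => ?_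
  have := hf i
  interval_cases h : f i <;> simp [h]

/-- Only the number of parts of each type matters. Since the parts act independently, coordinates
can be assigned to them as soon as the cardinalities fit: exactly for messages, as an inequality for
edges. -/
theorem IsFeasibleFamily.exists_isSimple_iff {ι : Type*} [Fintype ι]
    {p : ι → (M → ℕ) × (E → ℕ)} (hp : N.IsFeasibleFamily F p) {k : M → ℕ} {n : ℕ} :
    (∃ C : N.FractionalCode F k n, C.IsSimple) ↔ ∃ c : ι → ℕ,
      (∀ m, ∑ i, c i * (p i).1 m = k m) ∧ ∀ e, ∑ i, c i * (p i).2 e ≤ n * N.cap e := by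
  classical
  constructor
  · rintro ⟨-, -, D, -⟩
    -- Parts of weight zero have no type in the family. Dropping them changes no message dimension
    -- and only frees edge coordinates.
    let J := {j : Fin D.r // ∃ m, D.weight j m = true}
    have : ∀ j : J, ∃ i, p i = (fun m => (D.weight j.1 m).toNat,
        fun e => (decide ((D.part j.1).Uses e)).toNat) := fun j =>
      hp.complete (D.weight j.1) (fun e => decide ((D.part j.1).Uses e))
        ⟨D.part j.1, D.part_linear _, D.part_solution _, fun e he => by simpa using he⟩ j.2
    choose φ hφ using this
    have hsum : ∀ f : ι → ℕ, ∑ i, Fintype.card {j // φ j = i} * f i = ∑ j, f (φ j) := by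
      intro f
      rw [← Finset.sum_fiberwise Finset.univ φ]
      refine Finset.sum_congr rfl fun i _ => ?_
      rw [Finset.sum_congr rfl (g := fun _ => f i) fun j hj => by rw [(Finset.mem_filter.1 hj).2],
        Finset.sum_const, smul_eq_mul, Fintype.card_subtype]
    refine ⟨fun i => Fintype.card {j // φ j = i}, fun m => ?_, fun e => ?_⟩
    · rw [hsum fun i => (p i).1 m]
      simp only [hφ]
      rw [← Fintype.card_fin (k m), ← Fintype.card_congr (D.msgCoord m)]
      have : ∀ j : J, (D.weight j.1 m).toNat = if D.weight j.1 m = true then 1 else 0 := fun j => by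
        cases D.weight j.1 m <;> rfl
      simp only [this, ← Finset.card_filter]
      rw [← Fintype.card_subtype]
      exact Fintype.card_congr ⟨fun j => ⟨j.1.1, j.2⟩, fun j => ⟨⟨j.1, m, j.2⟩, j.2⟩,
        fun _ => rfl, fun _ => rfl⟩
    · rw [hsum fun i => (p i).2 e]
      simp only [hφ]
      refine le_trans ?_ ((Fintype.card_le_of_embedding (D.edgeCoord e)).trans_eq
        (Fintype.card_fin _))
      have : ∀ j : J, (decide ((D.part j.1).Uses e)).toNat =
          if (D.part j.1).Uses e then 1 else 0 := fun j => by
        by_cases h : (D.part j.1).Uses e <;> simp [h]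
      simp only [this, ← Finset.card_filter]
      rw [← Fintype.card_subtype]
      exact Fintype.card_le_of_injective
        (fun j : {j : J // (D.part j.1).Uses e} => (⟨j.1.1, j.2⟩ : {j // (D.part j).Uses e}))
        fun a b h => Subtype.ext (Subtype.ext (congrArg (fun x => x.1) h))
  · rintro ⟨c, hc, hu⟩
    choose C hl hs hS using hp.feasible
    let φ : Fin (Fintype.card (Σ i, Fin (c i))) ≃ Σ i, Fin (c i) := (Fintype.equivFin _).symm
    have h1 : ∀ m, Nonempty
        ({j // decide ((p (φ j).1).1 m = 1) = true} ≃ Fin (k m)) := by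
      intro m
      rw [← Fintype.card_eq, Fintype.card_fin, ← hc m,
        ← card_subtype_sigma c (fun i => (p i).1 m) (fun i => hp.msg_le_one i m) φ]
      exact Fintype.card_congr (Equiv.subtypeEquivRight fun j => by simp)
    have h2 : ∀ e, Nonempty ({j // (C (φ j).1).Uses e} ↪ Fin (n * N.cap e)) := by
      intro e
      refine Function.Embedding.nonempty_of_card_le ?_
      rw [Fintype.card_fin]
      refine le_trans ?_ (hu e)
      rw [← card_subtype_sigma c (fun i => (p i).2 e) (fun i => hp.edge_le_one i e) φ]
      -- The edge set of a type may be larger than the set of used edges, so this is only an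
      -- inequality.
      exact Fintype.card_subtype_mono _ _ fun j hj => hS _ e hj
    let D : N.AggregateData F k n :=
      { r := _
        weight := fun j m => decide ((p (φ j).1).1 m = 1)
        part := fun j => C (φ j).1
        part_linear := fun j => hl _
        part_solution := fun j => hs _
        msgCoord := fun m => (h1 m).some
        edgeCoord := fun e => (h2 e).some }
    exact ⟨D.code, D.code_isLinear, D, D.describes_code⟩

theorem semiLinearRegion_subset_linearRegion :
    N.semiLinearRegion F ⊆ N.linearRegion F := by
  refine closure_mono ?_
  rintro x ⟨k, n, hk, hn, ⟨C, hl, D, hD⟩, rfl⟩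
  exact ⟨k, n, hk, hn, ⟨C, hl, hD.isSolution⟩, rfl⟩

end CapacitatedNetwork

/-! ### Integral and fractional packings -/

section Packing

variable {ι M E : Type*} [Fintype ι] (p : ι → (M → ℕ) × (E → ℕ)) (cap : E → ℕ)

/-- The message dimensions that can be realised with `n` uses of the network, where `p i` lists
the messages and the edges of the `i`-th way to use it. -/
def achievable (n : ℕ) : Set (M → ℕ) :=
  {k | ∃ c : ι → ℕ, (∀ m, ∑ i, c i * (p i).1 m = k m) ∧ ∀ e, ∑ i, c i * (p i).2 e ≤ n * cap e}

/-- The polytope of fractional packings. -/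
def packingPolytope : Set (ι → ℝ) :=
  rationalPolyhedron (fun e i => ((p i).2 e : ℤ)) (fun e => (cap e : ℤ)) (∅ : Set E)

/-- The message rates of a fractional packing. -/
def rates : (ι → ℝ) →ₗ[ℝ] (M → ℝ) where
  toFun x m := ∑ i, x i * ((p i).1 m : ℝ)
  map_add' x y := by funext m; simp [add_mul, Finset.sum_add_distrib]
  map_smul' c x := by funext m; simp [mul_assoc, Finset.mul_sum]

variable {p cap}

theorem mem_packingPolytope {x : ι → ℝ} : x ∈ packingPolytope p cap ↔
    (∀ i, 0 ≤ x i) ∧ ∀ e, ∑ i, x i * ((p i).2 e : ℝ) ≤ cap e := by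
  simp [packingPolytope, rationalPolyhedron, mul_comm]

theorem rates_apply (x : ι → ℝ) (m : M) : rates p x m = ∑ i, x i * ((p i).1 m : ℝ) := rfl

/-- Each type occupies some edge, and the capacity of that edge bounds its multiplicity. -/
theorem isCompact_packingPolytope (hp : ∀ i, ∃ e, (p i).2 e = 1) :
    IsCompact (packingPolytope p cap) := by
  choose e he using hp
  refine isCompact_rationalPolyhedron (fun i => cap (e i)) fun x hx i => ?_
  have hx' := mem_packingPolytope.1 hx
  refine le_trans ?_ (hx'.2 (e i))
  refine le_trans (by simp [he]) (Finset.single_le_sum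
    (f := fun j => x j * ((p j).2 (e i) : ℝ)) (fun j _ => ?_) (Finset.mem_univ i))
  have := hx'.1 j
  positivity

/-- Each part carries `m` at most once and occupies at least one unit of the total capacity. -/
theorem le_of_mem_achievable [Fintype E] (hp : ∀ i, ∃ e, (p i).2 e = 1)
    (h1 : ∀ i m, (p i).1 m ≤ 1) {n : ℕ} {k : M → ℕ} (hk : k ∈ achievable p cap n) (m : M) :
    k m ≤ n * ∑ e, cap e := by
  obtain ⟨c, hc, hu⟩ := hk
  choose e he using hp
  rw [← hc m, Finset.mul_sum]
  calc ∑ i, c i * (p i).1 m ≤ ∑ i, ∑ e, c i * (p i).2 e := by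
        refine Finset.sum_le_sum fun i _ => ?_
        refine (Nat.mul_le_mul_left _ (h1 i m)).trans ?_
        have := Finset.single_le_sum (f := fun e => c i * (p i).2 e) (fun _ _ => Nat.zero_le _)
          (Finset.mem_univ (e i))
        simpa [he] using this
    _ = ∑ e, ∑ i, c i * (p i).2 e := Finset.sum_comm
    _ ≤ _ := Finset.sum_le_sum fun e _ => hu e

theorem finite_achievable [Finite M] [Fintype E] (hp : ∀ i, ∃ e, (p i).2 e = 1)
    (h1 : ∀ i m, (p i).1 m ≤ 1) (n : ℕ) : (achievable p cap n).Finite := by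
  cases nonempty_fintype M
  classical
  exact (Set.finite_Iic (fun _ : M => n * ∑ e, cap e)).subset
    fun k hk m => le_of_mem_achievable hp h1 hk m

theorem div_mem_packingPolytope {n : ℕ} (hn : 0 < n) {c : ι → ℕ}
    (hc : ∀ e, ∑ i, c i * (p i).2 e ≤ n * cap e) :
    (fun i => (c i : ℝ) / n) ∈ packingPolytope p cap := by
  have hn' : (0 : ℝ) < n := by exact_mod_cast hn
  refine mem_packingPolytope.2 ⟨fun i => by positivity, fun e => ?_⟩
  have : (∑ i, (c i : ℝ) * (p i).2 e) ≤ n * cap e := by exact_mod_cast hc e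
  simp only [div_mul_eq_mul_div, ← Finset.sum_div]
  rw [div_le_iff₀ hn', mul_comm (cap e : ℝ)]
  exact this

/-- The rates of fractional packings are the convex combinations of the achievable rates with a
fixed denominator. -/
theorem image_rates_packingPolytope [Fintype E] (hp : ∀ i, ∃ e, (p i).2 e = 1)
    (h2 : ∀ i e, (p i).2 e ≤ 1) :
    rates p '' packingPolytope p cap = convexHull ℝ ((fun (k : M → ℕ) m =>
      (k m : ℝ) / (commonDenominator (Fintype.card ι) (Fintype.card E) 1 : ℕ)) ''
        achievable p cap (commonDenominator (Fintype.card ι) (Fintype.card E) 1)) := by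
  set D := commonDenominator (Fintype.card ι) (Fintype.card E) 1 with hD
  have hD0 : 0 < D := commonDenominator_pos _ _ _
  have hD' : (0 : ℝ) < D := by exact_mod_cast hD0
  have hcomp := isCompact_packingPolytope (cap := cap) hp
  have hconv : Convex ℝ (packingPolytope p cap) := convex_rationalPolyhedron
  -- The coefficient matrix is 0-1, hence the bound 1; the capacities occur only on the right-hand
  -- side and do not affect `D`.
  have hext : ∀ x ∈ (packingPolytope p cap).extremePoints ℝ,
      ∃ y : ι → ℕ, ∀ i, (D : ℝ) * x i = y i := fun x hx =>
    exists_nat_of_mem_extremePoints hx le_rfl fun e i => by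
      rw [Nat.abs_cast]; exact_mod_cast h2 i e
  apply Set.Subset.antisymm
  -- The extreme points lie in a bounded part of the lattice `ℤ^ι / D`. Multiplied by `D`, they are
  -- integral packings for edge dimension `D`.
  · have hfin : ((packingPolytope p cap).extremePoints ℝ).Finite := by
      classical
      choose e he using hp
      refine ((Set.finite_Iic (fun i => D * cap (e i))).image
        fun (y : ι → ℕ) i => (y i : ℝ) / D).subset fun x hx => ?_
      obtain ⟨y, hy⟩ := hext x hx
      have hyx : (fun i => (y i : ℝ) / D) = x := by
        funext i; rw [← hy i, mul_div_cancel_left₀ _ hD'.ne']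
      refine ⟨y, fun i => ?_, hyx⟩
      have hx' := mem_packingPolytope.1 hx.1
      have : x i ≤ cap (e i) := by
        refine le_trans ?_ (hx'.2 (e i))
        refine le_trans (by simp [he]) (Finset.single_le_sum
          (f := fun j => x j * ((p j).2 (e i) : ℝ)) (fun j _ => ?_) (Finset.mem_univ i))
        have := hx'.1 j
        positivity
      have : (y i : ℝ) ≤ D * cap (e i) := by
        rw [← hy i]; exact mul_le_mul_of_nonneg_left this hD'.le
      exact_mod_cast this
    rw [← convexHull_extremePoints_eq hcomp hconv hfin, LinearMap.image_convexHull]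
    refine convexHull_mono ?_
    rintro _ ⟨x, hx, rfl⟩
    obtain ⟨y, hy⟩ := hext x hx
    refine ⟨fun m => ∑ i, y i * (p i).1 m, ⟨y, fun m => rfl, fun e => ?_⟩, ?_⟩
    · have := (mem_packingPolytope.1 hx.1).2 e
      have : (∑ i, (y i : ℝ) * (p i).2 e) ≤ D * cap e := by
        simp only [← hy, mul_assoc, ← Finset.mul_sum]
        exact mul_le_mul_of_nonneg_left this hD'.le
      exact_mod_cast this
    · funext m
      rw [rates_apply]
      push_cast
      simp only [← hy, mul_assoc, ← Finset.mul_sum]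
      rw [mul_div_cancel_left₀ _ hD'.ne']
  · refine convexHull_min ?_ (hconv.linear_image _)
    rintro _ ⟨k, ⟨c, hc, hu⟩, rfl⟩
    refine ⟨_, div_mem_packingPolytope hD0 hu, ?_⟩
    funext m
    rw [rates_apply]
    simp only [← hc m, div_mul_eq_mul_div, ← Finset.sum_div]
    push_cast
    rfl

end Packing

/-! ### The region as a projection of the packing polytope -/

namespace CapacitatedNetwork

variable {V E M : Type*} {N : CapacitatedNetwork V E M} {F : Type*} [Field F]
  {ι : Type*} {p : ι → (M → ℕ) × (E → ℕ)}

theorem IsFeasibleFamily.exists_edge [Finite M] (hN : N.NonDegenerate)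
    (hp : N.IsFeasibleFamily F p) (i : ι) : ∃ e, (p i).2 e = 1 := by
  obtain ⟨m, hm⟩ := hp.ne_zero i
  exact (hp.feasible i).nonempty hN (m := m) (by simpa using hm)

variable [Fintype ι]

/-- The image is compact and contains the rates of all simple codes, hence also their closure.
Conversely, any real packing is a limit of integral packings divided by the edge dimension,
corrected so that every message has positive dimension. -/
theorem IsFeasibleFamily.semiLinearRegion_eq_image [Finite M] [Finite E] (hN : N.NonDegenerate)
    (hp : N.IsFeasibleFamily F p) :
    N.semiLinearRegion F = rates p '' packingPolytope p N.cap := by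
  classical
  cases nonempty_fintype M
  have hcomp := (isCompact_packingPolytope (cap := N.cap) (hp.exists_edge hN)).image
    (rates p).continuous_of_finiteDimensional
  apply Set.Subset.antisymm
  · refine closure_minimal ?_ hcomp.isClosed
    rintro x ⟨k, n, hk, hn, hC, rfl⟩
    obtain ⟨c, hc, hu⟩ := hp.exists_isSimple_iff.1 hC
    refine ⟨_, div_mem_packingPolytope hn hu, ?_⟩
    funext m
    rw [rates_apply]
    simp only [← hc m, div_mul_eq_mul_div, ← Finset.sum_div]
    push_cast
    rfl
  · rintro _ ⟨x, hx, rfl⟩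
    obtain ⟨hx0, hxe⟩ := mem_packingPolytope.1 hx
    have hflood : ∀ m : M, ∃ i, p i = (fun m' => (decide (m' = m)).toNat, fun _ => 1) := by
      intro m
      obtain ⟨i, hi⟩ := hp.complete (fun m' => decide (m' = m)) (fun _ => true)
        (by simpa using hN.partialFeasible_single m) ⟨m, by simp⟩
      exact ⟨i, hi⟩
    choose φ hφ using hflood
    let d : ι → ℕ := fun i => Fintype.card {m // φ m = i}
    have hd : ∑ i, d i = Fintype.card M := by
      rw [← Fintype.card_sigma]
      exact Fintype.card_congr (Equiv.sigmaFiberEquiv φ)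
    -- One flood per message needs at most `Fintype.card M` units on each edge, and `K` extra units
    -- of edge dimension provide them because capacities are at least 1. The summand 1 keeps `n + K`
    -- positive even without messages.
    let K := Fintype.card M + 1
    let c : ℕ → ι → ℕ := fun n i => ⌊x i * n⌋₊ + d i
    have hlim : Filter.Tendsto (fun n : ℕ => fun i => (c n i : ℝ) / (n + K : ℕ)) Filter.atTop
        (nhds x) := by
      rw [tendsto_pi_nhds]
      intro i
      have h1 : Filter.Tendsto (fun n : ℕ => (⌊x i * (n : ℝ)⌋₊ : ℝ) / n) Filter.atTop
          (nhds (x i)) := (tendsto_nat_floor_mul_div_atTop (hx0 i)).comp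
            tendsto_natCast_atTop_atTop
      have h2 : Filter.Tendsto (fun n : ℕ => (n : ℝ) / (n + (K : ℝ))) Filter.atTop (nhds 1) :=
        tendsto_natCast_div_add_atTop (K : ℝ)
      have h3 : Filter.Tendsto (fun n : ℕ => (d i : ℝ) / ((n + K : ℕ) : ℝ)) Filter.atTop
          (nhds 0) := (tendsto_const_div_atTop_nhds_zero_nat (d i : ℝ)).comp
            (Filter.tendsto_add_atTop_nat K)
      have := (h1.mul h2).add h3
      rw [mul_one, add_zero] at this
      -- The quotient splits as `(⌊x i * n⌋ / n) * (n / (n + K)) + d i / (n + K)`.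
      refine this.congr fun n => ?_
      have hK : ((n : ℝ) + K) ≠ 0 := by positivity
      rcases Nat.eq_zero_or_pos n with rfl | hn
      · simp [c]
      · have : (n : ℝ) ≠ 0 := by positivity
        simp only [c]
        push_cast
        field_simp
    refine mem_closure_of_tendsto
      (((rates p).continuous_of_finiteDimensional.tendsto x).comp hlim)
      (Filter.Eventually.of_forall fun n => ?_)
    refine ⟨fun m => ∑ i, c n i * (p i).1 m, n + K, fun m => ?_, by positivity,
      hp.exists_isSimple_iff.2 ⟨c n, fun m => rfl, fun e => ?_⟩, ?_⟩
    · refine lt_of_lt_of_le ?_ (Finset.single_le_sum (f := fun i => c n i * (p i).1 m)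
        (fun _ _ => Nat.zero_le _) (Finset.mem_univ (φ m)))
      have : 0 < d (φ m) := Fintype.card_pos_iff.2 ⟨⟨m, rfl⟩⟩
      simp only [hφ, c]
      simpa using Or.inr this
    · have h1 : ∑ i, ⌊x i * n⌋₊ * (p i).2 e ≤ n * N.cap e := by
        have : ∑ i, (⌊x i * n⌋₊ : ℝ) * (p i).2 e ≤ n * N.cap e := by
          calc ∑ i, (⌊x i * n⌋₊ : ℝ) * (p i).2 e ≤ ∑ i, n * (x i * (p i).2 e) := by
                refine Finset.sum_le_sum fun i _ => ?_
                have := Nat.floor_le (mul_nonneg (hx0 i) (Nat.cast_nonneg n))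
                calc _ ≤ (x i * n) * ((p i).2 e : ℝ) :=
                      mul_le_mul_of_nonneg_right this (Nat.cast_nonneg _)
                  _ = _ := by ring
            _ ≤ _ := by
                rw [← Finset.mul_sum]
                exact mul_le_mul_of_nonneg_left (hxe e) (Nat.cast_nonneg n)
        exact_mod_cast this
      have h2 : ∑ i, d i * (p i).2 e ≤ K * N.cap e := by
        calc ∑ i, d i * (p i).2 e ≤ ∑ i, d i :=
              Finset.sum_le_sum fun i _ => by
                simpa using Nat.mul_le_mul_left (d i) (hp.edge_le_one i e)
          _ ≤ K := by rw [hd]; exact Nat.le_succ _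
          _ ≤ K * N.cap e := Nat.le_mul_of_pos_right _ (N.cap_pos e)
      simp only [c, add_mul, Finset.sum_add_distrib]
      exact add_le_add h1 h2
    · funext m
      rw [Function.comp_apply, rates_apply]
      simp only [div_mul_eq_mul_div, ← Finset.sum_div]
      push_cast
      rfl

theorem IsFeasibleFamily.semiLinearRegion_eq [Finite M] [Fintype E] (hN : N.NonDegenerate)
    (hp : N.IsFeasibleFamily F p) :
    N.semiLinearRegion F = convexHull ℝ ((fun (k : M → ℕ) m =>
      (k m : ℝ) / (commonDenominator (Fintype.card ι) (Fintype.card E) 1 : ℕ)) ''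
        achievable p N.cap (commonDenominator (Fintype.card ι) (Fintype.card E) 1)) := by
  rw [hp.semiLinearRegion_eq_image hN,
    image_rates_packingPolytope (hp.exists_edge hN) hp.edge_le_one]

variable (N F) in
theorem exists_isFeasibleFamily [Finite M] [Finite E] :
    ∃ (n : ℕ) (p : Fin n → (M → ℕ) × (E → ℕ)), N.IsFeasibleFamily F p := by
  classical
  let P := {q : (M → Bool) × (E → Bool) //
    N.PartialFeasible F q.1 {e | q.2 e = true} ∧ ∃ m, q.1 m = true}
  obtain ⟨n, ⟨φ⟩⟩ := Finite.exists_equiv_fin P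
  have hb : ∀ b : Bool, b.toNat = 1 ↔ b = true := by decide
  refine ⟨n, fun i => (fun m => ((φ.symm i).1.1 m).toNat, fun e => ((φ.symm i).1.2 e).toNat),
    fun i m => Bool.toNat_le _, fun i e => Bool.toNat_le _, fun i => ?_, fun i => ?_,
    fun w S h hw => ⟨φ ⟨(w, S), h, hw⟩, by simp⟩⟩
  · simpa [hb] using (φ.symm i).2.1
  · simpa [hb] using (φ.symm i).2.2

end CapacitatedNetwork

/-! ### Recognising vertices by a bounded search -/

section Vertices

variable {κ M : Type*} [Fintype κ] {pts : κ → M → ℕ} {q : M → ℕ}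

/-- The constraints that express `q` as a convex combination of those points `pts k` that are
different from `q`. -/
def combinationMatrix [DecidableEq (M → ℕ)] (pts : κ → M → ℕ) (q : M → ℕ) :
    Option (Option M) → κ → ℤ
  | none, _ => 1
  | some none, k => if pts k = q then 1 else 0
  | some (some m), k => pts k m

/-- The right-hand sides that belong to `combinationMatrix`. -/
def combinationVector (q : M → ℕ) : Option (Option M) → ℤ
  | none => 1
  | some none => 0
  | some (some m) => q m

/-- The single equation that the total weight on indices with `pts k = q` is zero kills each of
these weights, as they are nonnegative. -/
theorem mem_combinationPolytope [DecidableEq (M → ℕ)] {x : κ → ℝ} :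
    x ∈ rationalPolyhedron (combinationMatrix pts q) (combinationVector q) Set.univ ↔
      (∀ k, 0 ≤ x k) ∧ ∑ k, x k = 1 ∧ (∀ k, pts k = q → x k = 0) ∧
        ∀ m, ∑ k, x k * pts k m = q m := by
  have h : (∀ r, (∑ k, (combinationMatrix pts q r k : ℝ) * x k ≤ combinationVector q r) ∧
      (r ∈ Set.univ → ∑ k, (combinationMatrix pts q r k : ℝ) * x k = combinationVector q r)) ↔
      ∀ r, ∑ k, (combinationMatrix pts q r k : ℝ) * x k = combinationVector q r :=
    forall_congr' fun r => ⟨fun h => h.2 trivial, fun h => ⟨h.le, fun _ => h⟩⟩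
  refine and_congr_right fun h0 => h.trans ?_
  simp only [Option.forall]
  simp only [combinationMatrix, combinationVector, Int.cast_one, one_mul, Int.cast_zero,
    Int.cast_natCast, mul_comm (x _)]
  refine and_congr_right fun _ => and_congr_left fun _ => ?_
  rw [Finset.sum_eq_zero_iff_of_nonneg fun k _ => by
    have := h0 k
    split_ifs <;> simp [this]]
  refine forall_congr' fun k => ?_
  by_cases hk : pts k = q <;> simp [hk]

/-- The coefficients of such combinations form a compact polyhedron. If it is nonempty it has an
extreme point, whose denominators are bounded. -/
theorem exists_nat_combination [Fintype M] {B : ℕ} (hB : ∀ k m, pts k m ≤ B) {x : κ → ℝ}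
    (hx0 : ∀ k, 0 ≤ x k) (hx1 : ∑ k, x k = 1) (hxq : ∀ k, pts k = q → x k = 0)
    (hx : ∀ m, ∑ k, x k * pts k m = q m) :
    ∃ y : κ → ℕ,
      ∑ k, y k = commonDenominator (Fintype.card κ) (Fintype.card M + 2) (B + 1) ∧
      (∀ k, pts k = q → y k = 0) ∧ ∀ m, ∑ k, y k * pts k m =
        commonDenominator (Fintype.card κ) (Fintype.card M + 2) (B + 1) * q m := by
  classical
  have hmem : x ∈ rationalPolyhedron (combinationMatrix pts q) (combinationVector q) Set.univ :=
    mem_combinationPolytope.2 ⟨hx0, hx1, hxq, hx⟩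
  have hcomp : IsCompact
      (rationalPolyhedron (combinationMatrix pts q) (combinationVector q) Set.univ) := by
    refine isCompact_rationalPolyhedron (fun _ => 1) fun x hx k => ?_
    obtain ⟨h0, h1, -, -⟩ := mem_combinationPolytope.1 hx
    rw [← h1]
    exact Finset.single_le_sum (fun k _ => h0 k) (Finset.mem_univ k)
  obtain ⟨z, hz⟩ := hcomp.extremePoints_nonempty ⟨x, hmem⟩
  -- The entries are at most `B` or equal to 0 or 1; `B + 1` covers both cases, also for `B = 0`.
  obtain ⟨y, hy⟩ := exists_nat_of_mem_extremePoints hz (h := B + 1) (Nat.le_add_left _ _) (by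
    rintro (_ | _ | m) k
    · simp [combinationMatrix]
    · simp only [combinationMatrix]
      split_ifs
      · simp
      · simp
        positivity
    · simp only [combinationMatrix, Nat.abs_cast]
      exact_mod_cast (hB k m).trans (Nat.le_succ B))
  have hcard : Fintype.card (Option (Option M)) = Fintype.card M + 2 := by simp
  rw [hcard] at hy
  set D := commonDenominator (Fintype.card κ) (Fintype.card M + 2) (B + 1)
  obtain ⟨-, h1, hq, hm⟩ := mem_combinationPolytope.1 hz.1
  refine ⟨y, ?_, fun k hk => ?_, fun m => ?_⟩
  · have : ∑ k, (y k : ℝ) = D := by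
      simp only [← hy, ← Finset.mul_sum, h1, mul_one]
    exact_mod_cast this
  · have : (y k : ℝ) = 0 := by rw [← hy, hq k hk, mul_zero]
    exact_mod_cast this
  · have : ∑ k, (y k : ℝ) * pts k m = D * q m := by
      simp only [← hy, mul_assoc, ← Finset.mul_sum, hm]
    exact_mod_cast this

/-- A point of a finite set of integer vectors is a vertex of the convex hull unless it is a
convex combination, with bounded denominators, of the other points. -/
theorem mem_extremePoints_convexHull_iff [Fintype M] {B D : ℕ} (hD : 0 < D)
    (hB : ∀ k m, pts k m ≤ B) (hq : q ∈ Set.range pts) :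
    (fun m => (q m : ℝ) / D) ∈ (convexHull ℝ
      ((fun (k : M → ℕ) m => (k m : ℝ) / D) '' Set.range pts)).extremePoints ℝ ↔
    ¬ ∃ y : κ → ℕ,
      ∑ k, y k = commonDenominator (Fintype.card κ) (Fintype.card M + 2) (B + 1) ∧
      (∀ k, pts k = q → y k = 0) ∧ ∀ m, ∑ k, y k * pts k m =
        commonDenominator (Fintype.card κ) (Fintype.card M + 2) (B + 1) * q m := by
  classical
  have hD' : (0 : ℝ) < D := by exact_mod_cast hD
  set f : (M → ℕ) → M → ℝ := fun k m => (k m : ℝ) / D with hf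
  have hinj : Function.Injective f := by
    intro a b h
    funext m
    have := congrFun h m
    simp only [hf] at this
    rw [div_left_inj' hD'.ne'] at this
    exact_mod_cast this
  have hfin : (f '' Set.range pts).Finite := (Set.finite_range pts).image f
  constructor
  · rintro hext ⟨y, h1, h0, hm⟩
    set C := commonDenominator (Fintype.card κ) (Fintype.card M + 2) (B + 1)
    have hC : (0 : ℝ) < C := by exact_mod_cast commonDenominator_pos _ _ _
    -- An extreme point is not in the hull of the remaining points of the set. Only indices with `y
    -- k ≠ 0` are summed, since their points are known to differ from `q`.
    rw [(convex_convexHull ℝ _).mem_extremePoints_iff_mem_sdiff_convexHull_sdiff] at hext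
    refine hext.2 ?_
    have hmem : ∑ k ∈ Finset.univ.filter (fun k => y k ≠ 0), ((y k : ℝ) / C) • f (pts k) ∈
        convexHull ℝ (convexHull ℝ (f '' Set.range pts) \ {f q}) := by
      refine (convex_convexHull ℝ _).sum_mem (fun k _ => by positivity) ?_ fun k hk => ?_
      · rw [← Finset.sum_div, div_eq_one_iff_eq hC.ne', ← h1]
        push_cast
        refine Finset.sum_subset (Finset.filter_subset _ _) fun k _ hk => ?_
        simpa using hk
      · refine subset_convexHull ℝ _ ⟨subset_convexHull ℝ _ ⟨_, ⟨k, rfl⟩, rfl⟩, fun h => ?_⟩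
        exact (Finset.mem_filter.1 hk).2 (h0 k (hinj h))
    convert hmem using 1
    rw [Finset.sum_subset (Finset.filter_subset _ _) fun k _ hk => by
      have : y k = 0 := by simpa using hk
      simp [this]]
    funext m
    have : ∑ k, (y k : ℝ) * pts k m = C * q m := by exact_mod_cast hm m
    simp only [hf, Finset.sum_apply, Pi.smul_apply, smul_eq_mul]
    have h2 : ∀ k, (y k : ℝ) / C * ((pts k m : ℝ) / D) = (y k * pts k m) / (C * D) :=
      fun k => div_mul_div_comm _ _ _ _
    simp only [h2, ← Finset.sum_div, this]
    exact (mul_div_mul_left _ _ hC.ne').symm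
  · intro hno
    by_contra hext
    -- If `f q` is not extreme, all extreme points lie among the other generators, so these already
    -- span the hull and `f q` is a combination of them.
    have hsub : (convexHull ℝ (f '' Set.range pts)).extremePoints ℝ ⊆
        (f '' Set.range pts) \ {f q} := fun x hx =>
      ⟨extremePoints_convexHull_subset hx, fun h => by
        rw [Set.mem_singleton_iff.1 h] at hx
        exact hext hx⟩
    have hmem : f q ∈ convexHull ℝ ((f '' Set.range pts) \ {f q}) := by
      refine convexHull_mono hsub ?_
      rw [convexHull_extremePoints_eq (hfin.isCompact_convexHull ℝ) (convex_convexHull ℝ _)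
        (hfin.subset extremePoints_convexHull_subset)]
      exact subset_convexHull ℝ _ ⟨q, hq, rfl⟩
    obtain ⟨α, _, w, z, hw0, hw1, hz, hwz⟩ := mem_convexHull_iff_exists_fintype.1 hmem
    have : ∀ a, ∃ k, f (pts k) = z a ∧ pts k ≠ q := by
      intro a
      obtain ⟨⟨_, ⟨k, rfl⟩, hk⟩, hne⟩ := hz a
      exact ⟨k, hk, fun h => hne (by rw [← hk, h]; rfl)⟩
    choose φ hφ hφq using this
    -- The weights of the combination are collected along `φ`, which transfers them to the index set
    -- of `pts`.
    have hsum : ∀ g : κ → ℝ, ∑ k, (∑ a with φ a = k, w a) * g k = ∑ a, w a * g (φ a) := by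
      intro g
      rw [← Finset.sum_fiberwise Finset.univ φ]
      refine Finset.sum_congr rfl fun k _ => ?_
      rw [Finset.sum_mul]
      exact Finset.sum_congr rfl fun a ha => by rw [(Finset.mem_filter.1 ha).2]
    refine hno (exists_nat_combination hB (x := fun k => ∑ a with φ a = k, w a)
      (fun k => Finset.sum_nonneg fun a _ => hw0 a) ?_ (fun k hk => ?_) fun m => ?_)
    · simpa [hw1] using hsum fun _ => 1
    · refine Finset.sum_eq_zero fun a ha => ?_
      exact absurd ((Finset.mem_filter.1 ha).2 ▸ hk) (hφq a)
    · rw [hsum fun k => (pts k m : ℝ)]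
      have := congrFun hwz m
      simp only [← hφ, hf, Finset.sum_apply, Pi.smul_apply, smul_eq_mul, mul_div_assoc',
        ← Finset.sum_div] at this
      rwa [div_left_inj' hD'.ne'] at this

end Vertices

-- Closure properties of primitive recursive functions

attribute [fun_prop] Primrec
attribute [fun_prop] Primrec.id Primrec.const Primrec.comp Primrec.fst Primrec.snd Primrec.pair

section PrimrecClosure

variable {α β σ : Type*} [Primcodable α] [Primcodable β] [Primcodable σ]

namespace Primrec

@[fun_prop]
theorem add_comp {f g : α → ℕ} (hf : Primrec f) (hg : Primrec g) :
    Primrec fun a => f a + g a := nat_add.comp hf hg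

@[fun_prop]
theorem mul_comp {f g : α → ℕ} (hf : Primrec f) (hg : Primrec g) :
    Primrec fun a => f a * g a := nat_mul.comp hf hg

@[fun_prop]
theorem div_comp {f g : α → ℕ} (hf : Primrec f) (hg : Primrec g) :
    Primrec fun a => f a / g a := nat_div.comp hf hg

@[fun_prop]
theorem mod_comp {f g : α → ℕ} (hf : Primrec f) (hg : Primrec g) :
    Primrec fun a => f a % g a := nat_mod.comp hf hg

@[fun_prop]
theorem pow_comp {f g : α → ℕ} (hf : Primrec f) (hg : Primrec g) :
    Primrec fun a => f a ^ g a :=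
  (Primrec₂.unpaired'.1 Nat.Primrec.pow).comp hf hg

@[fun_prop]
theorem factorial_comp {f : α → ℕ} (hf : Primrec f) : Primrec fun a => (f a).factorial := by
  have h : Primrec (fun n : ℕ =>
      (Nat.rec 1 (fun k x => (k + 1) * x) n : ℕ)) :=
    nat_rec₁ (f := fun k x => (k + 1) * x) 1
      (show Primrec fun p : ℕ × ℕ => (p.1 + 1) * p.2 by fun_prop)
  refine (h.of_eq fun n => ?_).comp hf
  induction n with
  | zero => rfl
  | succ n ih => exact congrArg ((n + 1) * ·) ih

@[fun_prop]
theorem getD_comp {f : α → List β} {g : α → ℕ} {d : β} (hf : Primrec f) (hg : Primrec g) :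
    Primrec fun a => (f a).getD (g a) d := (list_getD d).comp hf hg

@[fun_prop]
theorem cons_comp {f : α → β} {g : α → List β} (hf : Primrec f) (hg : Primrec g) :
    Primrec fun a => f a :: g a := list_cons.comp hf hg

@[fun_prop]
theorem length_comp {f : α → List β} (hf : Primrec f) : Primrec fun a => (f a).length :=
  list_length.comp hf

@[fun_prop]
theorem range_comp {f : α → ℕ} (hf : Primrec f) : Primrec fun a => List.range (f a) :=
  list_range.comp hf

@[fun_prop]
theorem map_comp {f : α → List β} {g : α → β → σ} (hf : Primrec f)
    (hg : Primrec fun p : α × β => g p.1 p.2) : Primrec fun a => (f a).map (g a) :=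
  list_map hf hg

@[fun_prop]
theorem flatMap_comp {f : α → List β} {g : α → β → List σ} (hf : Primrec f)
    (hg : Primrec fun p : α × β => g p.1 p.2) : Primrec fun a => (f a).flatMap (g a) :=
  list_flatMap hf hg

@[fun_prop]
theorem sum_comp {f : α → List ℕ} (hf : Primrec f) : Primrec fun a => (f a).sum :=
  list_foldr (h := fun _ p => p.1 + p.2) hf (const 0)
    (show Primrec fun p : α × (ℕ × ℕ) => p.2.1 + p.2.2 by fun_prop)

/-- Any function on a finite type is primitive recursive, so addition in a finite field needs no
concrete implementation. -/
theorem sum_comp_of_finite [Finite β] [AddMonoid β] {f : α → List β} (hf : Primrec f) :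
    Primrec fun a => (f a).sum :=
  list_foldr (h := fun _ p => p.1 + p.2) hf (const 0)
    ((dom_finite fun p : β × β => p.1 + p.2).comp snd)

theorem filter_comp {f : α → List β} {p : α → β → Prop} {_ : ∀ a, DecidablePred (p a)}
    (hf : Primrec f) (hp : PrimrecPred fun x : α × β => p x.1 x.2) :
    Primrec fun a => (f a).filter (p a ·) := by
  have h : PrimrecRel fun (b : β) (a : α) => p a b :=
    hp.comp (show Primrec fun x : β × α => (x.2, x.1) by fun_prop)
  exact (h.listFilter).comp hf Primrec.id

end Primrec

namespace PrimrecPred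

theorem imp {p q : α → Prop} (hp : PrimrecPred p) (hq : PrimrecPred q) :
    PrimrecPred fun a => p a → q a :=
  (hp.not.or hq).of_eq fun _ => imp_iff_not_or.symm

theorem eq_comp {f g : α → β} (hf : Primrec f) (hg : Primrec g) :
    PrimrecPred fun a => f a = g a := Primrec.eq.comp hf hg

theorem le_comp {f g : α → ℕ} (hf : Primrec f) (hg : Primrec g) :
    PrimrecPred fun a => f a ≤ g a := Primrec.nat_le.comp hf hg

theorem ball_mem {f : α → List β} {p : α → β → Prop} (hf : Primrec f)
    (hp : PrimrecPred fun x : α × β => p x.1 x.2) : PrimrecPred fun a => ∀ b ∈ f a, p a b := by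
  have h : PrimrecRel fun (b : β) (a : α) => p a b :=
    hp.comp (show Primrec fun x : β × α => (x.2, x.1) by fun_prop)
  exact h.forall_mem_list.comp hf Primrec.id

theorem bex_mem {f : α → List β} {p : α → β → Prop} (hf : Primrec f)
    (hp : PrimrecPred fun x : α × β => p x.1 x.2) : PrimrecPred fun a => ∃ b ∈ f a, p a b := by
  have h : PrimrecRel fun (b : β) (a : α) => p a b :=
    hp.comp (show Primrec fun x : β × α => (x.2, x.1) by fun_prop)
  exact h.exists_mem_list.comp hf Primrec.id

theorem ball_lt {f : α → ℕ} {p : α → ℕ → Prop} (hf : Primrec f)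
    (hp : PrimrecPred fun x : α × ℕ => p x.1 x.2) : PrimrecPred fun a => ∀ i < f a, p a i := by
  exact (ball_mem (Primrec.range_comp hf) hp).of_eq fun a => by simp

end PrimrecPred

end PrimrecClosure

/-! ### Enumeration of lists and fractions in lowest terms -/

/-- All lists of a given length with entries in the list `A`. -/
def listsOver {α : Type*} (A : List α) : ℕ → List (List α)
  | 0 => [[]]
  | n + 1 => (listsOver A n).flatMap fun l => A.map fun a => a :: l

@[fun_prop]
theorem Primrec.listsOver_comp {α β : Type*} [Primcodable α] [Primcodable β] {A : α → List β}
    {n : α → ℕ} (hA : Primrec A) (hn : Primrec n) : Primrec fun a => listsOver (A a) (n a) := by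
  have h : Primrec fun a => (Nat.rec [[]]
      (fun _ (x : List (List β)) => x.flatMap fun l => (A a).map fun b => b :: l) (n a) :
        List (List β)) :=
    Primrec.nat_rec' (h := fun a (p : ℕ × List (List β)) =>
      p.2.flatMap fun l => (A a).map fun b => b :: l) hn (Primrec.const _)
      (show Primrec fun x : α × (ℕ × List (List β)) =>
        x.2.2.flatMap fun l => (A x.1).map fun b => b :: l by fun_prop)
  refine h.of_eq fun a => ?_
  induction n a with
  | zero => rfl
  | succ n ih => exact congrArg (fun x : List (List β) => x.flatMap _) ih

theorem mem_listsOver {α : Type*} {A : List α} {n : ℕ} {l : List α} :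
    l ∈ listsOver A n ↔ l.length = n ∧ ∀ a ∈ l, a ∈ A := by
  induction n generalizing l with
  | zero => cases l <;> simp [listsOver]
  | succ n ih =>
    simp only [listsOver, List.mem_flatMap, List.mem_map, ih]
    cases l with
    | nil => simp
    | cons b l => simp; tauto

theorem nodup_listsOver {α : Type*} {A : List α} (hA : A.Nodup) (n : ℕ) :
    (listsOver A n).Nodup := by
  induction n with
  | zero => simp [listsOver]
  | succ n ih =>
    rw [listsOver, List.nodup_flatMap]
    refine ⟨fun l _ => hA.map fun a b h => (List.cons.inj h).1, ih.imp ?_⟩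
    intro l l' hne
    simp only [Function.onFun, List.disjoint_left, List.mem_map]
    rintro _ ⟨a, -, rfl⟩ ⟨b, -, h⟩
    exact hne (List.cons.inj h).2.symm

/-- The bridge between the bounded search of the algorithm and quantification over vectors. -/
theorem exists_mem_listsOver {α : Type*} {A : List α} {n : ℕ} {P : List α → Prop} :
    (∃ l ∈ listsOver A n, P l) ↔ ∃ f : Fin n → α, (∀ i, f i ∈ A) ∧ P (List.ofFn f) := by
  constructor
  · rintro ⟨l, hl, hP⟩
    obtain ⟨rfl, hA⟩ := mem_listsOver.1 hl
    exact ⟨l.get, fun i => hA _ (List.get_mem _ _), by rwa [List.ofFn_get]⟩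
  · rintro ⟨f, hf, hP⟩
    refine ⟨_, mem_listsOver.2 ⟨List.length_ofFn, fun a ha => ?_⟩, hP⟩
    obtain ⟨i, rfl⟩ := List.mem_ofFn.1 ha
    exact hf i

theorem forall_mem_listsOver {α : Type*} {A : List α} {n : ℕ} {P : List α → Prop} :
    (∀ l ∈ listsOver A n, P l) ↔ ∀ f : Fin n → α, (∀ i, f i ∈ A) → P (List.ofFn f) := by
  have := exists_mem_listsOver (A := A) (n := n) (P := fun l => ¬ P l)
  rw [← not_iff_not]
  push Not
  simpa using this

theorem getD_ofFn {α : Type*} {n : ℕ} (f : Fin n → α) (d : α) (i : Fin n) :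
    (List.ofFn f).getD i d = f i := by
  rw [List.getD_eq_getElem _ _ (by simp)]
  simp

theorem sum_map_range {β : Type*} [AddCommMonoid β] (n : ℕ) (f : ℕ → β) :
    ((List.range n).map f).sum = ∑ i : Fin n, f i := by
  rw [Fin.sum_univ_eq_sum_range, ← List.sum_toFinset _ List.nodup_range, List.toFinset_range]

theorem forall_lt_iff_fin {n : ℕ} {P : ℕ → Prop} : (∀ i < n, P i) ↔ ∀ i : Fin n, P i :=
  ⟨fun h i => h i i.2, fun h i hi => h ⟨i, hi⟩⟩

@[fun_prop]
theorem Primrec.commonDenominator_comp {α : Type*} [Primcodable α] {n r h : α → ℕ}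
    (hn : Primrec n) (hr : Primrec r) (hh : Primrec h) :
    Primrec fun a => commonDenominator (n a) (r a) (h a) := by
  unfold commonDenominator
  fun_prop

/-- The fraction `a / b` in lowest terms. -/
def lowestTerms (a b : ℕ) : ℕ × ℕ :=
  let g := Nat.findGreatest (fun g => a % g = 0 ∧ b % g = 0) b
  (a / g, b / g)

-- The greatest common divisor is found by a search bounded by the denominator, which is visibly
-- primitive recursive.
@[fun_prop]
theorem Primrec.lowestTerms_comp {α : Type*} [Primcodable α] {f g : α → ℕ} (hf : Primrec f)
    (hg : Primrec g) : Primrec fun a => lowestTerms (f a) (g a) := by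
  have h : Primrec fun a => Nat.findGreatest (fun d => f a % d = 0 ∧ g a % d = 0) (g a) := by
    refine Primrec.nat_findGreatest (p := fun a d => f a % d = 0 ∧ g a % d = 0) hg ?_
    refine PrimrecPred.primrecRel (p := fun x : α × ℕ => f x.1 % x.2 = 0 ∧ g x.1 % x.2 = 0) ?_
    exact (PrimrecPred.eq_comp (by fun_prop) (by fun_prop)).and
      (PrimrecPred.eq_comp (by fun_prop) (by fun_prop))
  unfold lowestTerms
  fun_prop

theorem lowestTerms_eq {a b : ℕ} (hb : 0 < b) :
    lowestTerms a b = (((a : ℚ) / b).num.toNat, ((a : ℚ) / b).den) := by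
  have hg : Nat.findGreatest (fun g => a % g = 0 ∧ b % g = 0) b = a.gcd b := by
    rw [Nat.findGreatest_eq_iff]
    refine ⟨Nat.gcd_le_right _ hb, fun _ => ⟨Nat.mod_eq_zero_of_dvd (Nat.gcd_dvd_left _ _),
      Nat.mod_eq_zero_of_dvd (Nat.gcd_dvd_right _ _)⟩, fun n hn _ h => ?_⟩
    have := Nat.le_of_dvd (Nat.gcd_pos_of_pos_right a hb)
      (Nat.dvd_gcd (Nat.dvd_of_mod_eq_zero h.1) (Nat.dvd_of_mod_eq_zero h.2))
    omega
  have hgpos : 0 < a.gcd b := Nat.gcd_pos_of_pos_right a hb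
  have hg0 : (a.gcd b : ℚ) ≠ 0 := by positivity
  have h : (a : ℚ) / b = ((a / a.gcd b : ℕ) : ℤ) / ((b / a.gcd b : ℕ) : ℤ) := by
    rw [Int.cast_natCast, Int.cast_natCast, Nat.cast_div (Nat.gcd_dvd_left _ _) hg0,
      Nat.cast_div (Nat.gcd_dvd_right _ _) hg0, div_div_div_cancel_right₀ hg0]
  have hpos : (0 : ℤ) < ((b / a.gcd b : ℕ) : ℤ) := by
    exact_mod_cast Nat.div_pos (Nat.gcd_le_right _ hb) hgpos
  have hcop : Nat.Coprime (((a / a.gcd b : ℕ) : ℤ)).natAbs (((b / a.gcd b : ℕ) : ℤ)).natAbs := by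
    rw [Int.natAbs_natCast, Int.natAbs_natCast]
    exact Nat.coprime_div_gcd_div_gcd hgpos
  have hnum := Rat.num_div_eq_of_coprime hpos hcop
  have hden := Rat.den_div_eq_of_coprime hpos hcop
  rw [lowestTerms, hg, h]
  refine Prod.ext ?_ ?_
  · simp only [hnum, Int.toNat_natCast]
  · simp only
    exact_mod_cast hden.symm

/-! ### The algorithm on descriptions -/

namespace CapacitatedNetwork

namespace Description

/-- The number of edges. -/
def edgeCount (d : Description) : ℕ := d.2.2.2.1.length

/-- The tail, the head and the capacity of an edge. -/
def edgeAt (d : Description) (i : ℕ) : ℕ × ℕ × ℕ := d.2.2.2.1.getD i (0, 0, 0)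

/-- The messages generated at a node. -/
def sourceAt (d : Description) (x : ℕ) : List ℕ := d.2.2.2.2.1.getD x []

/-- The messages demanded at a node. -/
def receiverAt (d : Description) (x : ℕ) : List ℕ := d.2.2.2.2.2.getD x []

section Primrec

variable {α : Type*} [Primcodable α] {f : α → Description} {i : α → ℕ}

@[fun_prop]
theorem edgeCount_primrec (hf : Primrec f) : Primrec fun a => edgeCount (f a) := by
  unfold edgeCount
  fun_prop

@[fun_prop]
theorem edgeAt_primrec (hf : Primrec f) (hi : Primrec i) :
    Primrec fun a => edgeAt (f a) (i a) := by
  unfold edgeAt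
  fun_prop

@[fun_prop]
theorem sourceAt_primrec (hf : Primrec f) (hi : Primrec i) :
    Primrec fun a => sourceAt (f a) (i a) := by
  unfold sourceAt
  fun_prop

@[fun_prop]
theorem receiverAt_primrec (hf : Primrec f) (hi : Primrec i) :
    Primrec fun a => receiverAt (f a) (i a) := by
  unfold receiverAt
  fun_prop

end Primrec

section Feasibility

variable {F : Type*} [Field F]

/-- The pairing of two vectors of length `n` that are given as lists. -/
def listDot (n : ℕ) (g a : List F) : F :=
  ((List.range n).map fun j => g.getD j 0 * a.getD j 0).sum

/-- The list version of `CapacitatedNetwork.VanishesAt`. -/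
def VanishesAt (d : Description) (g : List (List F)) (x : ℕ) (a : List F) : Prop :=
  (∀ j ∈ sourceAt d x, a.getD j 0 = 0) ∧
    ∀ i < edgeCount d, (edgeAt d i).2.1 = x → listDot d.2.1 (g.getD i []) a = 0

/-- The list version of `CapacitatedNetwork.IsKernelSolution`, for one message assignment `a`. -/
def IsKernelSolutionAt (d : Description) (w S : List ℕ) (g : List (List F)) (a : List F) : Prop :=
  (∀ j < d.2.1, ¬ w.getD j 0 = 1 → a.getD j 0 = 0) →
    (∀ i < edgeCount d, (S.getD i 0 = 1 → VanishesAt d g (edgeAt d i).1 a) →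
      listDot d.2.1 (g.getD i []) a = 0) ∧
    ∀ x < d.1, ∀ j ∈ receiverAt d x, w.getD j 0 = 1 → VanishesAt d g x a → a.getD j 0 = 0

/-- The list version of `CapacitatedNetwork.PartialFeasible`, where `A` lists the field. -/
def IsFeasible (A : List F) (d : Description) (p : List ℕ × List ℕ) : Prop :=
  ∃ g ∈ listsOver (listsOver A d.2.1) (edgeCount d), ∀ a ∈ listsOver A d.2.1,
    IsKernelSolutionAt d p.1 p.2 g a

open Classical in
/-- The nonzero weight vectors together with the edge sets that admit a partial solution. -/
noncomputable def feasiblePairs (A : List F) (d : Description) : List (List ℕ × List ℕ) :=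
  ((listsOver [0, 1] d.2.1).flatMap fun w => (listsOver [0, 1] (edgeCount d)).map fun S =>
    (w, S)).filter fun p => (∃ j ∈ p.1, j = 1) ∧ IsFeasible A d p

variable [Finite F] [Primcodable F]

section

variable {α : Type*} [Primcodable α] {d : α → Description} {w S : α → List ℕ}
  {g : α → List (List F)} {a : α → List F} {x : α → ℕ}

@[fun_prop]
theorem listDot_primrec {n : α → ℕ} {u v : α → List F} (hn : Primrec n) (hu : Primrec u)
    (hv : Primrec v) : Primrec fun t => listDot (n t) (u t) (v t) := by
  unfold listDot
  refine Primrec.sum_comp_of_finite (Primrec.map_comp (by fun_prop) ?_)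
  exact (Primrec.dom_finite fun p : F × F => p.1 * p.2).comp
    (show Primrec fun p : α × ℕ => ((u p.1).getD p.2 0, (v p.1).getD p.2 0) by fun_prop)

theorem vanishesAt_primrec (hd : Primrec d) (hg : Primrec g) (hx : Primrec x) (ha : Primrec a) :
    PrimrecPred fun t => VanishesAt (d t) (g t) (x t) (a t) := by
  classical
  unfold VanishesAt
  refine PrimrecPred.and ?_ ?_
  · exact PrimrecPred.ball_mem (by fun_prop) (PrimrecPred.eq_comp (by fun_prop) (by fun_prop))
  · exact PrimrecPred.ball_lt (by fun_prop) (PrimrecPred.imp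
      (PrimrecPred.eq_comp (by fun_prop) (by fun_prop))
      (PrimrecPred.eq_comp (by fun_prop) (by fun_prop)))

theorem isKernelSolutionAt_primrec (hd : Primrec d) (hw : Primrec w) (hS : Primrec S)
    (hg : Primrec g) (ha : Primrec a) :
    PrimrecPred fun t => IsKernelSolutionAt (d t) (w t) (S t) (g t) (a t) := by
  classical
  unfold IsKernelSolutionAt
  refine PrimrecPred.imp (PrimrecPred.ball_lt (by fun_prop) (PrimrecPred.imp
    (PrimrecPred.eq_comp (by fun_prop) (by fun_prop)).not
    (PrimrecPred.eq_comp (by fun_prop) (by fun_prop)))) (PrimrecPred.and ?_ ?_)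
  · exact PrimrecPred.ball_lt (by fun_prop) (PrimrecPred.imp (PrimrecPred.imp
      (PrimrecPred.eq_comp (by fun_prop) (by fun_prop))
      (vanishesAt_primrec (by fun_prop) (by fun_prop) (by fun_prop) (by fun_prop)))
      (PrimrecPred.eq_comp (by fun_prop) (by fun_prop)))
  · exact PrimrecPred.ball_lt (by fun_prop) (PrimrecPred.ball_mem (by fun_prop)
      (PrimrecPred.imp (PrimrecPred.eq_comp (by fun_prop) (by fun_prop)) (PrimrecPred.imp
      (vanishesAt_primrec (by fun_prop) (by fun_prop) (by fun_prop) (by fun_prop))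
      (PrimrecPred.eq_comp (by fun_prop) (by fun_prop)))))

end

-- Classical decidability in the definition is harmless: being primitive recursive is a property of
-- the function alone, and the filter uses only quantifiers bounded by computed lists. The list `A`
-- of field elements is a constant.
@[fun_prop]
theorem feasiblePairs_primrec (A : List F) : Primrec (feasiblePairs A) := by
  classical
  unfold feasiblePairs
  refine Primrec.filter_comp (by fun_prop) (PrimrecPred.and (PrimrecPred.bex_mem (by fun_prop)
    (PrimrecPred.eq_comp (by fun_prop) (by fun_prop))) ?_)
  exact PrimrecPred.bex_mem (by fun_prop) (PrimrecPred.ball_mem (by fun_prop)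
    (isKernelSolutionAt_primrec (by fun_prop) (by fun_prop) (by fun_prop) (by fun_prop)
      (by fun_prop)))

end Feasibility

section Vertices

variable {F : Type*} [Field F] (A : List F)

/-- A common denominator of the vertices of the region. -/
noncomputable def denominator (d : Description) : ℕ :=
  commonDenominator (feasiblePairs A d).length (edgeCount d) 1

/-- A bound for the numerators of the vertices of the region. -/
noncomputable def rateBound (d : Description) : ℕ :=
  denominator A d * ((List.range (edgeCount d)).map fun i => (edgeAt d i).2.2).sum

/-- Using the `i`-th partial solution `c i` times yields the source dimensions `k` and respects
the capacities for the edge dimension `denominator A d`. -/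
def IsPacking (d : Description) (k c : List ℕ) : Prop :=
  (∀ j < d.2.1, ((List.range (feasiblePairs A d).length).map fun i =>
    c.getD i 0 * ((feasiblePairs A d).getD i ([], [])).1.getD j 0).sum = k.getD j 0) ∧
  ∀ e < edgeCount d, ((List.range (feasiblePairs A d).length).map fun i =>
    c.getD i 0 * ((feasiblePairs A d).getD i ([], [])).2.getD e 0).sum ≤
      denominator A d * (edgeAt d e).2.2

open Classical in
/-- The source dimensions achievable with the edge dimension `denominator A d`. -/
noncomputable def points (d : Description) : List (List ℕ) :=
  (listsOver (List.range (rateBound A d + 1)) d.2.1).filter fun k =>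
    ∃ c ∈ listsOver (List.range (rateBound A d + 1)) (feasiblePairs A d).length, IsPacking A d k c

/-- The denominator up to which convex combinations of the points have to be searched. -/
noncomputable def testDenominator (d : Description) : ℕ :=
  commonDenominator (points A d).length (d.2.1 + 2) (rateBound A d + 1)

/-- The list `y` represents `q` as a convex combination of the other points. -/
def IsCombination (d : Description) (q y : List ℕ) : Prop :=
  ((List.range (points A d).length).map fun k => y.getD k 0).sum = testDenominator A d ∧
  (∀ k < (points A d).length, (points A d).getD k [] = q → y.getD k 0 = 0) ∧
  ∀ j < d.2.1, ((List.range (points A d).length).map fun k =>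
    y.getD k 0 * ((points A d).getD k []).getD j 0).sum = testDenominator A d * q.getD j 0

open Classical in
/-- The vertices of the region, multiplied with `denominator A d`. -/
noncomputable def vertices (d : Description) : List (List ℕ) :=
  (points A d).filter fun q =>
    ¬ ∃ y ∈ listsOver (List.range (testDenominator A d + 1)) (points A d).length,
      IsCombination A d q y

/-- The coordinates of the vertices of the region in lowest terms. -/
noncomputable def regionVertices (d : Description) : List (List (ℕ × ℕ)) :=
  (vertices A d).map fun q =>
    (List.range d.2.1).map fun j => lowestTerms (q.getD j 0) (denominator A d)

variable [Finite F] [Primcodable F]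

@[fun_prop]
theorem denominator_primrec : Primrec (denominator A) := by
  unfold denominator
  fun_prop

@[fun_prop]
theorem rateBound_primrec : Primrec (rateBound A) := by
  unfold rateBound
  fun_prop

@[fun_prop]
theorem points_primrec : Primrec (points A) := by
  classical
  unfold points IsPacking
  refine Primrec.filter_comp (by fun_prop) (PrimrecPred.bex_mem (by fun_prop)
    (PrimrecPred.and ?_ ?_))
  · exact PrimrecPred.ball_lt (by fun_prop) (PrimrecPred.eq_comp (by fun_prop) (by fun_prop))
  · exact PrimrecPred.ball_lt (by fun_prop) (PrimrecPred.le_comp (by fun_prop) (by fun_prop))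

@[fun_prop]
theorem testDenominator_primrec : Primrec (testDenominator A) := by
  unfold testDenominator
  fun_prop

@[fun_prop]
theorem vertices_primrec : Primrec (vertices A) := by
  classical
  unfold vertices IsCombination
  refine Primrec.filter_comp (by fun_prop) (PrimrecPred.not (PrimrecPred.bex_mem (by fun_prop)
    (PrimrecPred.and ?_ (PrimrecPred.and ?_ ?_))))
  · exact PrimrecPred.eq_comp (by fun_prop) (by fun_prop)
  · exact PrimrecPred.ball_lt (by fun_prop) (PrimrecPred.imp
      (PrimrecPred.eq_comp (by fun_prop) (by fun_prop))
      (PrimrecPred.eq_comp (by fun_prop) (by fun_prop)))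
  · exact PrimrecPred.ball_lt (by fun_prop) (PrimrecPred.eq_comp (by fun_prop) (by fun_prop))

theorem regionVertices_primrec : Primrec (regionVertices A) := by
  unfold regionVertices
  fun_prop

end Vertices

end Description

end CapacitatedNetwork

/-! ### Correctness of the algorithm -/

/-- The vector whose coordinates are the entries of a list. -/
def listVec (n : ℕ) (l : List ℕ) : Fin n → ℕ := fun i => l.getD i 0

theorem listVec_ofFn {n : ℕ} (f : Fin n → ℕ) : listVec n (List.ofFn f) = f :=
  funext fun i => getD_ofFn f 0 i

theorem ofFn_listVec {n : ℕ} {l : List ℕ} (hl : l.length = n) : List.ofFn (listVec n l) = l := by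
  subst hl
  refine List.ext_getElem (by simp) fun i h1 h2 => ?_
  simp [listVec, h2]

theorem listVec_inj {n : ℕ} {l l' : List ℕ} (hl : l.length = n) (hl' : l'.length = n) :
    listVec n l = listVec n l' ↔ l = l' :=
  ⟨fun h => by rw [← ofFn_listVec hl, h, ofFn_listVec hl'], fun h => h ▸ rfl⟩

namespace CapacitatedNetwork

open Description

section Network

variable {v e m : ℕ} (N : CapacitatedNetwork (Fin v) (Fin e) (Fin m)) {F : Type*} [Field F]

theorem description_nodes : N.description.1 = v := rfl

theorem description_msgs : N.description.2.1 = m := rfl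

theorem edgeCount_description : edgeCount N.description = e := List.length_ofFn

theorem edgeAt_description (i : Fin e) :
    edgeAt N.description i = ((N.tail i : ℕ), (N.head i : ℕ), N.cap i) :=
  getD_ofFn (fun i : Fin e => ((N.tail i : ℕ), (N.head i : ℕ), N.cap i)) _ i

theorem forall_mem_sourceAt {x : Fin v} {P : ℕ → Prop} :
    (∀ j ∈ sourceAt N.description x, P j) ↔ ∀ j ∈ N.source x, P j := by
  have : sourceAt N.description x =
      ((List.finRange m).filter (· ∈ N.source x)).map Fin.val :=
    getD_ofFn (fun x => ((List.finRange m).filter (· ∈ N.source x)).map Fin.val) _ x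
  simp [this]

theorem forall_mem_receiverAt {x : Fin v} {P : ℕ → Prop} :
    (∀ j ∈ receiverAt N.description x, P j) ↔ ∀ j ∈ N.receiver x, P j := by
  have : receiverAt N.description x =
      ((List.finRange m).filter (· ∈ N.receiver x)).map Fin.val :=
    getD_ofFn (fun x => ((List.finRange m).filter (· ∈ N.receiver x)).map Fin.val) _ x
  simp [this]

theorem listDot_ofFn (g a : Fin m → F) :
    listDot m (List.ofFn g) (List.ofFn a) = g ⬝ᵥ a := by
  simp only [listDot, sum_map_range, getD_ofFn, dotProduct]

theorem vanishesAt_description (g : Fin e → Fin m → F) (x : Fin v) (a : Fin m → F) :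
    Description.VanishesAt N.description (List.ofFn fun i => List.ofFn (g i)) x (List.ofFn a) ↔
      N.VanishesAt g x a := by
  simp only [Description.VanishesAt, VanishesAt, forall_mem_sourceAt, edgeCount_description,
    forall_lt_iff_fin, edgeAt_description, description_msgs, getD_ofFn, listDot_ofFn, Fin.val_inj]

theorem forall_isKernelSolutionAt_iff (w S : List ℕ) (g : Fin e → Fin m → F) :
    (∀ a : Fin m → F, IsKernelSolutionAt N.description w S
      (List.ofFn fun i => List.ofFn (g i)) (List.ofFn a)) ↔
    N.IsKernelSolution (fun j => decide (listVec m w j = 1)) {i | listVec e S i = 1} g := by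
  simp only [IsKernelSolutionAt, description_msgs, description_nodes, edgeCount_description,
    forall_lt_iff_fin, edgeAt_description, forall_mem_receiverAt, getD_ofFn, listDot_ofFn,
    vanishesAt_description]
  constructor
  · intro h
    have h0 : ∀ a : Fin m → F, (∀ j, decide (listVec m w j = 1) = false → a j = 0) →
        ∀ j : Fin m, ¬ w.getD j 0 = 1 → a j = 0 := fun a ha j hj => ha j (by simpa [listVec] using hj)
    -- The list version merges two conditions: for an edge outside `S` the premise is vacuous, so
    -- its form must vanish; for an edge in `S` it is the kernel condition.
    exact ⟨fun i hi a ha => (h a (h0 a ha)).1 i fun hS => absurd hS hi,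
      fun i a ha hv => (h a (h0 a ha)).1 i fun _ => hv,
      fun x j hj hw a ha hv => (h a (h0 a ha)).2 x j hj (by simpa [listVec] using hw) hv⟩
  · intro h a ha
    have h0 : ∀ j, decide (listVec m w j = 1) = false → a j = 0 :=
      fun j hj => ha j (by simpa [listVec] using hj)
    refine ⟨fun i hi => ?_, fun x j hj hw hv => h.dec x j hj (by simpa [listVec] using hw) a h0 hv⟩
    by_cases hS : S.getD i 0 = 1
    · exact h.edge i a h0 (hi hS)
    · exact h.unused i hS a h0

theorem isFeasible_description {A : List F} (hA : ∀ x, x ∈ A) (q : List ℕ × List ℕ) :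
    IsFeasible A N.description q ↔ N.PartialFeasible F
      (fun j => decide (listVec m q.1 j = 1)) {i | listVec e q.2 i = 1} := by
  rw [partialFeasible_iff]
  simp only [← forall_isKernelSolutionAt_iff, IsFeasible, edgeCount_description, description_msgs,
    forall_mem_listsOver, hA, implies_true, forall_const]
  rw [exists_mem_listsOver]
  constructor
  · rintro ⟨f, hf, h⟩
    have : ∀ i, ∃ g : Fin m → F, f i = List.ofFn g := by
      intro i
      obtain ⟨hl, -⟩ := mem_listsOver.1 (hf i)
      exact ⟨fun j => (f i).get (Fin.cast hl.symm j), by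
        conv_lhs => rw [← List.ofFn_get (f i)]
        exact List.ofFn_congr hl _⟩
    choose g hg using this
    obtain rfl : f = fun i => List.ofFn (g i) := funext hg
    exact ⟨g, h⟩
  · rintro ⟨g, h⟩
    exact ⟨fun i => List.ofFn (g i),
      fun i => mem_listsOver.2 ⟨List.length_ofFn, fun a _ => hA a⟩, h⟩

variable {N} (A : List F)

/-- The partial solutions found for the description of a network, as 0-1 vectors. -/
noncomputable def pairVec (N : CapacitatedNetwork (Fin v) (Fin e) (Fin m))
    (i : Fin (feasiblePairs A N.description).length) : (Fin m → ℕ) × (Fin e → ℕ) :=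
  (listVec m ((feasiblePairs A N.description).getD i ([], [])).1,
    listVec e ((feasiblePairs A N.description).getD i ([], [])).2)

variable {A}

theorem mem_feasiblePairs (hA : ∀ x, x ∈ A) {q : List ℕ × List ℕ} :
    q ∈ feasiblePairs A N.description ↔
      ((q.1.length = m ∧ ∀ j ∈ q.1, j ∈ [0, 1]) ∧ (q.2.length = e ∧ ∀ i ∈ q.2, i ∈ [0, 1])) ∧
      (∃ j ∈ q.1, j = 1) ∧ N.PartialFeasible F
        (fun j => decide (listVec m q.1 j = 1)) {i | listVec e q.2 i = 1} := by
  rw [← isFeasible_description N hA]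
  obtain ⟨w, S⟩ := q
  simp only [feasiblePairs, List.mem_filter, decide_eq_true_eq, List.mem_flatMap, List.mem_map,
    mem_listsOver, description_msgs, edgeCount_description]
  refine and_congr_left fun _ => ⟨?_, fun h => ⟨w, h.1, S, h.2, rfl⟩⟩
  rintro ⟨w', hw, S', hS, h⟩
  obtain ⟨rfl, rfl⟩ := Prod.mk.inj h
  exact ⟨hw, hS⟩

theorem listVec_le_one {n : ℕ} {l : List ℕ} (hl : ∀ j ∈ l, j ∈ [0, 1]) (i : Fin n) :
    listVec n l i ≤ 1 := by
  by_cases h : (i : ℕ) < l.length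
  · rw [listVec, List.getD_eq_getElem _ _ h]
    have := hl _ (List.getElem_mem h)
    simp only [List.mem_cons, List.not_mem_nil, or_false] at this
    omega
  · rw [listVec, List.getD_eq_default _ _ (not_lt.1 h)]
    exact Nat.zero_le _

theorem isFeasibleFamily_pairVec (hA : ∀ x, x ∈ A) : N.IsFeasibleFamily F (pairVec A N) := by
  have hmem : ∀ i : Fin (feasiblePairs A N.description).length,
      (feasiblePairs A N.description).getD i ([], []) ∈ feasiblePairs A N.description := by
    intro i
    rw [List.getD_eq_getElem _ _ i.2]
    exact List.getElem_mem _
  refine ⟨fun i j => listVec_le_one ((mem_feasiblePairs hA).1 (hmem i)).1.1.2 j,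
    fun i j => listVec_le_one ((mem_feasiblePairs hA).1 (hmem i)).1.2.2 j,
    fun i => ((mem_feasiblePairs hA).1 (hmem i)).2.2, fun i => ?_, fun w S h hw => ?_⟩
  · obtain ⟨⟨⟨hl, -⟩, -⟩, ⟨j, hj, h1⟩, -⟩ := (mem_feasiblePairs hA).1 (hmem i)
    obtain ⟨n, hn, rfl⟩ := List.getElem_of_mem hj
    refine ⟨⟨n, hl ▸ hn⟩, ?_⟩
    simp only [pairVec, listVec]
    rw [List.getD_eq_getElem _ _ hn, h1]
  · have hb : ∀ b : Bool, b.toNat = 1 ↔ b = true := by decide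
    have hb' : ∀ b : Bool, b.toNat ∈ [0, 1] := by decide
    have hq : (List.ofFn fun j => (w j).toNat, List.ofFn fun i => (S i).toNat) ∈
        feasiblePairs A N.description := by
      refine (mem_feasiblePairs hA).2 ⟨⟨⟨List.length_ofFn, fun a ha => ?_⟩, List.length_ofFn,
        fun a ha => ?_⟩, ?_, ?_⟩
      · obtain ⟨j, rfl⟩ := List.mem_ofFn.1 ha
        exact hb' _
      · obtain ⟨j, rfl⟩ := List.mem_ofFn.1 ha
        exact hb' _
      · obtain ⟨j, hj⟩ := hw
        exact ⟨_, List.mem_ofFn.2 ⟨j, rfl⟩, (hb _).2 hj⟩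
      · simp only [listVec_ofFn, hb, Bool.decide_eq_true]
        exact h
    obtain ⟨n, hn, h⟩ := List.getElem_of_mem hq
    refine ⟨⟨n, hn⟩, ?_⟩
    simp only [pairVec]
    rw [List.getD_eq_getElem _ _ hn, h, listVec_ofFn, listVec_ofFn]

theorem denominator_pos : 0 < denominator A N.description := commonDenominator_pos _ _ _

theorem rateBound_description : rateBound A N.description =
    denominator A N.description * ∑ i, N.cap i := by
  simp only [rateBound, edgeCount_description, sum_map_range, edgeAt_description]

/-- The search range suffices: the entries of `k` and the multiplicities `c` are both bounded by the
total capacity for this edge dimension, the latter because every type occupies an edge. -/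
theorem mem_points (hN : N.NonDegenerate) (hA : ∀ x, x ∈ A) {k : List ℕ} :
    k ∈ points A N.description ↔ k.length = m ∧
      listVec m k ∈ achievable (pairVec A N) N.cap (denominator A N.description) := by
  classical
  have hp := isFeasibleFamily_pairVec (N := N) hA
  have hedge := hp.exists_edge hN
  have hpack : ∀ c : Fin (feasiblePairs A N.description).length → ℕ,
      IsPacking A N.description k (List.ofFn c) ↔
        (∀ j, ∑ i, c i * (pairVec A N i).1 j = listVec m k j) ∧
          ∀ i, ∑ l, c l * (pairVec A N l).2 i ≤ denominator A N.description * N.cap i := by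
    intro c
    simp only [IsPacking, description_msgs, edgeCount_description, forall_lt_iff_fin,
      sum_map_range, getD_ofFn, edgeAt_description]
    rfl
  simp only [points, List.mem_filter, decide_eq_true_eq]
  rw [exists_mem_listsOver]
  simp only [mem_listsOver, description_msgs, hpack, List.mem_range, Nat.lt_succ_iff,
    rateBound_description]
  constructor
  · rintro ⟨⟨hl, -⟩, c, -, hc⟩
    exact ⟨hl, c, hc⟩
  · rintro ⟨hl, hk⟩
    have hb := fun j => le_of_mem_achievable hedge hp.msg_le_one hk j
    obtain ⟨c, hc⟩ := hk
    refine ⟨⟨hl, fun a ha => ?_⟩, c, fun i => ?_, hc⟩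
    · obtain ⟨n, hn, rfl⟩ := List.getElem_of_mem ha
      have := hb ⟨n, hl ▸ hn⟩
      simpa [listVec, hn] using this
    · obtain ⟨f, hf⟩ := hedge i
      calc c i ≤ ∑ l, c l * (pairVec A N l).2 f := by
            refine le_trans (by simp [hf]) (Finset.single_le_sum
              (f := fun l => c l * (pairVec A N l).2 f) (fun _ _ => Nat.zero_le _)
              (Finset.mem_univ i))
        _ ≤ _ := hc.2 f
        _ ≤ _ := Nat.mul_le_mul_left _
            (Finset.single_le_sum (f := N.cap) (fun _ _ => Nat.zero_le _) (Finset.mem_univ f))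

/-- The points found for the description of a network, as vectors. -/
noncomputable def pointVec (A : List F) (N : CapacitatedNetwork (Fin v) (Fin e) (Fin m))
    (k : Fin (points A N.description).length) : Fin m → ℕ :=
  listVec m ((points A N.description).getD k [])

theorem getD_mem_points (k : Fin (points A N.description).length) :
    (points A N.description).getD k [] ∈ points A N.description := by
  rw [List.getD_eq_getElem _ _ k.2]
  exact List.getElem_mem _

theorem range_pointVec (hN : N.NonDegenerate) (hA : ∀ x, x ∈ A) :
    Set.range (pointVec A N) =
      achievable (pairVec A N) N.cap (denominator A N.description) := by
  ext q
  constructor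
  · rintro ⟨k, rfl⟩
    exact ((mem_points hN hA).1 (getD_mem_points k)).2
  · intro hq
    have : List.ofFn q ∈ points A N.description :=
      (mem_points hN hA).2 ⟨List.length_ofFn, by rwa [listVec_ofFn]⟩
    obtain ⟨n, hn, h⟩ := List.getElem_of_mem this
    refine ⟨⟨n, hn⟩, ?_⟩
    simp only [pointVec]
    rw [List.getD_eq_getElem _ _ hn, h, listVec_ofFn]

theorem semiLinearRegion_eq_convexHull_pointVec (hN : N.NonDegenerate) (hA : ∀ x, x ∈ A) :
    N.semiLinearRegion F = convexHull ℝ ((fun (k : Fin m → ℕ) j =>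
      (k j : ℝ) / denominator A N.description) '' Set.range (pointVec A N)) := by
  rw [(isFeasibleFamily_pairVec hA).semiLinearRegion_eq hN, range_pointVec hN hA]
  simp only [denominator, edgeCount_description, Fintype.card_fin]

/-- The search for `y` is exhaustive because nonnegative coefficients are bounded by their
prescribed sum. The length condition makes a list correspond to exactly one vector. -/
theorem mem_vertices (hN : N.NonDegenerate) (hA : ∀ x, x ∈ A) {q : List ℕ} :
    q ∈ vertices A N.description ↔ q.length = m ∧
      (fun j => (listVec m q j : ℝ) / denominator A N.description) ∈
        (N.semiLinearRegion F).extremePoints ℝ := by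
  classical
  have hp := isFeasibleFamily_pairVec (N := N) hA
  have hD' : (0 : ℝ) < denominator A N.description := by exact_mod_cast denominator_pos
  have hmem : q ∈ points A N.description ↔
      q.length = m ∧ listVec m q ∈ Set.range (pointVec A N) := by
    rw [range_pointVec hN hA, mem_points hN hA]
  have hB : ∀ k j, pointVec A N k j ≤ rateBound A N.description := by
    intro k j
    have h := range_pointVec hN hA ▸ Set.mem_range_self k
    rw [rateBound_description]
    exact le_of_mem_achievable (hp.exists_edge hN) hp.msg_le_one h j
  have hext : q.length = m → listVec m q ∈ Set.range (pointVec A N) →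
      ((¬ ∃ y ∈ listsOver (List.range (testDenominator A N.description + 1))
        (points A N.description).length, IsCombination A N.description q y) ↔
      (fun j => (listVec m q j : ℝ) / denominator A N.description) ∈
        (N.semiLinearRegion F).extremePoints ℝ) := by
    intro hl hq
    rw [semiLinearRegion_eq_convexHull_pointVec hN hA,
      mem_extremePoints_convexHull_iff denominator_pos hB hq, not_iff_not, exists_mem_listsOver]
    have htest : commonDenominator (Fintype.card (Fin (points A N.description).length))
        (Fintype.card (Fin m) + 2) (rateBound A N.description + 1) =
          testDenominator A N.description := by
      simp only [testDenominator, description_msgs, Fintype.card_fin]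
    rw [htest]
    have hcomb : ∀ y : Fin (points A N.description).length → ℕ,
        IsCombination A N.description q (List.ofFn y) ↔
          ∑ k, y k = testDenominator A N.description ∧
          (∀ k, pointVec A N k = listVec m q → y k = 0) ∧
          ∀ j, ∑ k, y k * pointVec A N k j =
            testDenominator A N.description * listVec m q j := by
      intro y
      simp only [IsCombination, description_msgs, forall_lt_iff_fin, sum_map_range, getD_ofFn]
      refine and_congr_right fun _ => and_congr_left fun _ => forall_congr' fun k => ?_
      rw [pointVec, listVec_inj ((mem_points hN hA).1 (getD_mem_points k)).1 hl]
    simp only [hcomb, List.mem_range, Nat.lt_succ_iff]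
    refine exists_congr fun y => ⟨fun h => h.2, fun h => ⟨fun k => ?_, h⟩⟩
    rw [← h.1]
    exact Finset.single_le_sum (fun _ _ => Nat.zero_le _) (Finset.mem_univ k)
  simp only [vertices, List.mem_filter, decide_eq_true_eq, hmem]
  constructor
  · rintro ⟨⟨hl, hq⟩, h⟩
    exact ⟨hl, (hext hl hq).1 h⟩
  · rintro ⟨hl, h⟩
    -- Extreme points of a hull are generators, and division by the positive denominator is
    -- injective.
    have hq : listVec m q ∈ Set.range (pointVec A N) := by
      have h' := h
      rw [semiLinearRegion_eq_convexHull_pointVec hN hA] at h'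
      obtain ⟨k, hk, hkq⟩ := extremePoints_convexHull_subset h'
      have : k = listVec m q := by
        funext j
        have := congrFun hkq j
        simp only at this
        rw [div_left_inj' hD'.ne'] at this
        exact_mod_cast this
      exact this ▸ hk
    exact ⟨⟨hl, hq⟩, (hext hl hq).2 h⟩

theorem nodup_vertices : (vertices A N.description).Nodup :=
  ((nodup_listsOver List.nodup_range _).filter _).filter _

/-- The vertices of the region are computed correctly. -/
theorem regionVertices_description (hN : N.NonDegenerate) (hA : ∀ x, x ∈ A) :
    ∃ L : List (Fin m → ℚ), L.Nodup ∧ (∀ q ∈ L, ∀ i, 0 ≤ q i) ∧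
      regionVertices A N.description = writeVectors L ∧
      ratVec '' {q | q ∈ L} = Set.extremePoints ℝ (N.semiLinearRegion F) ∧
      N.semiLinearRegion F = convexHull ℝ (ratVec '' {q | q ∈ L}) := by
  have hD : (0 : ℚ) < denominator A N.description := by exact_mod_cast denominator_pos
  have hlen : ∀ q ∈ vertices A N.description, q.length = m :=
    fun q hq => ((mem_vertices hN hA).1 hq).1
  have hfin : (Set.range (pointVec A N)).Finite := Set.finite_range _
  have hsub : (N.semiLinearRegion F).extremePoints ℝ ⊆ (fun (k : Fin m → ℕ) j =>
      (k j : ℝ) / denominator A N.description) '' Set.range (pointVec A N) := by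
    rw [semiLinearRegion_eq_convexHull_pointVec hN hA]
    exact extremePoints_convexHull_subset
  have himage : ratVec '' {q | q ∈ (vertices A N.description).map
      fun (q : List ℕ) (i : Fin m) => (listVec m q i : ℚ) / denominator A N.description} =
        (N.semiLinearRegion F).extremePoints ℝ := by
    ext x
    constructor
    · rintro ⟨q, hq, rfl⟩
      obtain ⟨l, hl, rfl⟩ := List.mem_map.1 hq
      convert ((mem_vertices hN hA).1 hl).2 using 1
      funext j
      simp [ratVec]
    · intro hx
      obtain ⟨k, -, rfl⟩ := hsub hx
      refine ⟨_, List.mem_map.2 ⟨List.ofFn k, (mem_vertices hN hA).2 ⟨List.length_ofFn, ?_⟩, rfl⟩,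
        ?_⟩
      · rwa [listVec_ofFn]
      · rw [listVec_ofFn]
        funext j
        simp [ratVec]
  refine ⟨_, nodup_vertices.map_on (f := fun (q : List ℕ) (i : Fin m) =>
    (listVec m q i : ℚ) / denominator A N.description) fun a ha b hb h => ?_, ?_, ?_, himage, ?_⟩
  · refine (listVec_inj (hlen a ha) (hlen b hb)).1 (funext fun j => ?_)
    have := congrFun h j
    rw [div_left_inj' hD.ne'] at this
    exact_mod_cast this
  · intro q hq i
    obtain ⟨l, -, rfl⟩ := List.mem_map.1 hq
    positivity
  · rw [regionVertices, writeVectors, List.map_map]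
    refine List.map_congr_left fun q _ => ?_
    rw [description_msgs, Function.comp_apply]
    refine List.ext_getElem (by simp) fun i h1 h2 => ?_
    simp only [List.getElem_map, List.getElem_range, List.getElem_ofFn]
    exact lowestTerms_eq denominator_pos
  · rw [himage, semiLinearRegion_eq_convexHull_pointVec hN hA]
    exact (convexHull_extremePoints_eq ((hfin.image _).isCompact_convexHull ℝ)
      (convex_convexHull ℝ _) ((hfin.image _).subset extremePoints_convexHull_subset)).symm

end Network

end CapacitatedNetwork

theorem isRationalPolytope_convexHull_div {M : Type*} {K : Set (M → ℕ)} (hK : K.Finite) (D : ℕ) :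
    IsRationalPolytope (convexHull ℝ ((fun (k : M → ℕ) m => (k m : ℝ) / D) '' K)) := by
  refine ⟨(fun (k : M → ℕ) m => (k m : ℚ) / D) '' K, hK.image _, ?_⟩
  rw [Set.image_image]
  exact congrArg _ (Set.image_congr fun k _ => by funext m; simp [ratVec])

theorem theorem4 (F : Type*) [Field F] [Finite F] :
    (∀ (V E M : Type*) [Finite V] [Finite E] [Finite M] (N : CapacitatedNetwork V E M),
      N.NonDegenerate → N.alphabetCard ≤ Nat.card F →
        IsRationalPolytope (N.semiLinearRegion F) ∧
        Bornology.IsBounded (N.semiLinearRegion F) ∧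
        (∀ x ∈ N.semiLinearRegion F, ∀ m, 0 ≤ x m) ∧
        N.semiLinearRegion F ⊆ N.linearRegion F) ∧
    ∃ f : CapacitatedNetwork.Description → List (List (ℕ × ℕ)), Computable f ∧
      ∀ (v e m : ℕ) (N : CapacitatedNetwork (Fin v) (Fin e) (Fin m)),
        N.NonDegenerate → N.alphabetCard ≤ Nat.card F →
          ∃ L : List (Fin m → ℚ), L.Nodup ∧ (∀ q ∈ L, ∀ i, 0 ≤ q i) ∧
            f N.description = writeVectors L ∧
            ratVec '' {q | q ∈ L} = Set.extremePoints ℝ (N.semiLinearRegion F) ∧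
            N.semiLinearRegion F = convexHull ℝ (ratVec '' {q | q ∈ L}) := by
  constructor
  · intro V E M _ _ _ N hN _
    cases nonempty_fintype E
    obtain ⟨n, p, hp⟩ := CapacitatedNetwork.exists_isFeasibleFamily N F
    have hedge := hp.exists_edge hN
    refine ⟨?_, ?_, ?_, CapacitatedNetwork.semiLinearRegion_subset_linearRegion⟩
    · rw [hp.semiLinearRegion_eq hN]
      exact isRationalPolytope_convexHull_div (finite_achievable hedge hp.msg_le_one _) _
    · cases nonempty_fintype M
      rw [hp.semiLinearRegion_eq_image hN]
      exact ((isCompact_packingPolytope hedge).image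
        (rates p).continuous_of_finiteDimensional).isBounded
    · rw [hp.semiLinearRegion_eq_image hN]
      rintro _ ⟨x, hx, rfl⟩ m
      rw [rates_apply]
      exact Finset.sum_nonneg fun i _ =>
        mul_nonneg ((mem_packingPolytope.1 hx).1 i) (Nat.cast_nonneg _)
  · cases nonempty_fintype F
    obtain ⟨n, ⟨φ⟩⟩ := Finite.exists_equiv_fin F
    -- Any numbering of the finite field will do: it affects the search but not the correctness of
    -- the result.
    let _ : Primcodable F := Primcodable.ofEquiv (Fin n) φ
    exact ⟨CapacitatedNetwork.Description.regionVertices (Finset.univ : Finset F).toList,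
      (CapacitatedNetwork.Description.regionVertices_primrec _).to_comp, fun v e m N hN _ =>
        CapacitatedNetwork.regionVertices_description hN fun x => by simp⟩
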